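/- Let $(E,\|\cdot\|_E)$ be a real Banach space of Rademacher type $p\in[1,2]$, let $q\in[p,\infty)$ and $k,M\in\mathbb{N}=\{1,2,\dots\}$, and let $\xi_1,\dots,\xi_M\in L_{kq}(\Omega;E)$ be independent and identically distributed $E$-valued (strongly measurable) random variables on a probability space $(\Omega,\mathcal{A},\mathbb{P})$. Write $\otimes^k x = x\otimes\cdots\otimes x$ ($k$ factors). The $k$-fold injective tensor product $\otimes^k_\varepsilon E$ is the completion of the algebraic tensor product $\otimes^k E$ with respect to $\|U\|_\varepsilon=\sup\{|\langle f_1\otimes\cdots\otimes f_k,U\rangle| : f_1,\dots,f_k\in E',\ \|f_n\|_{E'}\le 1\}$. The $k$-fold symmetric injective tensor product $\otimes^{k,s}_{\varepsilon_s}E$ is the completion of the space $\otimes^{k,s}E\subseteq\otimes^kE$ of symmetric tensors (the linear span of the symmetrizations $\frac1{k!}\sum_{\sigma\in S_k}x_{\sigma(1)}\otimes\cdots\otimes x_{\sigma(k)}$) with respect to $\bigl\|\sum_j\lambda_j\otimes^k x_j\bigr\|_{\varepsilon_s}=\sup\bigl\{\bigl|\sum_j\lambda_j f(x_j)^k\bigr|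 : f\in E',\ \|f\|_{E'}\le1\bigr\}$. The closure of $\otimes^{k,s}E$ in $\otimes^k_\varepsilon E$ is identified with $\otimes^{k,s}_{\varepsilon_s}E$ through the continuous extension $\otimes^k_\varepsilon E\to\otimes^{k,s}_{\varepsilon_s}E$ of the symmetrization. Then the injective $k$-th moment $\mathbb{M}^k_\varepsilon[\xi_1]:=\mathbb{E}[\otimes^k\xi_1]$ exists as a Bochner integral in $\otimes^k_\varepsilon E$ and belongs to (the closure of) the symmetric tensors, the error $\mathbb{M}^k_\varepsilon[\xi_1]-\frac1M\sum_{j=1}^M\otimes^k\xi_j$ belongs to $L_q(\Omega;\otimes^{k,s}_{\varepsilon_s}E)$, and $$\Bigl\|\mathbb{M}^k_\varepsilon[\xi_1]-\frac1M\sum_{j=1}^M\otimes^k\xi_j\Bigr\|_{L_q(\Omega;\otimes^{k,s}_{\varepsilon_s}E)}\le 2\bigl(2k\,K_{q,p}\,\tau_p(E)+B_q\bigr)\,M^{-(1-\frac1p)}\,\|\xi_1\|_{L_{kq}(\Omega;E)}^k .$$ Here, for any Rademacher family $(r_j)_{j\in\mathbb{N}}$ (independent, $\pm1$ with probability $\frac12$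 each) on any complete probability space $\widetilde\Omega$: $E$ is of Rademacher type $p$ if there is $\tau\in(0,\infty)$ with $\|\sum_{j=1}^n r_jx_j\|_{L_p(\widetilde\Omega;E)}\le\tau(\sum_{j=1}^n\|x_j\|_E^p)^{1/p}$ for all $n$ and $x_1,\dots,x_n\in E$, and $\tau_p(E)$ is the infimum of all such $\tau$; $K_{q,p}$ is the smallest $K\in(0,\infty)$ with $\|\sum_{j=1}^n r_jx_j\|_{L_q(\widetilde\Omega;F)}\le K\|\sum_{j=1}^n r_jx_j\|_{L_p(\widetilde\Omega;F)}$ for all real Banach spaces $F$, all $n$ and $x_1,\dots,x_n\in F$; and $B_q$ is the smallest $B\in(0,\infty)$ with $\|\sum_{j=1}^n r_ja_j\|_{L_q(\widetilde\Omega;\mathbb{R})}\le B(\sum_{j=1}^n a_j^2)^{1/2}$ for all $n$ and $a_1,\dots,a_n\in\mathbb{R}$. -/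

import Mathlib

open MeasureTheory ProbabilityTheory
open scoped TensorProduct ENNReal Nat

universe u v w

noncomputable section

namespace MonteCarloMoments

/-! ### Rademacher families and the constants attached to them -/

/-- `r` is a Rademacher family on `(Ω, P)`: independent random variables with values in `{-1, 1}`,
each value being attained with probability `1/2`. -/
structure IsRademacherFamily {Ω : Type w} [MeasurableSpace Ω] (r : ℕ → Ω → ℝ) (P : Measure Ω) :
    Prop where
  measurable : ∀ j, Measurable (r j)
  range : ∀ j ω, r j ω = -1 ∨ r j ω = 1
  prob_neg_one : ∀ j, P {ω | r j ω = -1} = 1 / 2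
  prob_one : ∀ j, P {ω | r j ω = 1} = 1 / 2
  indep : iIndepFun r P

/-- `K ∈ (0,∞)` is admissible in the Kahane–Khintchine inequality
`‖∑ r_j x_j‖_{L_q} ≤ K ‖∑ r_j x_j‖_{L_p}` for all Rademacher families on complete probability
spaces and all finite families of vectors in an arbitrary real Banach space. -/
def IsKahaneKhintchineBound (q p K : ℝ) : Prop :=
  0 < K ∧
  ∀ (Ω : Type w) [MeasurableSpace Ω] (P : Measure Ω) [IsProbabilityMeasure P] [P.IsComplete]
    (r : ℕ → Ω → ℝ), IsRademacherFamily r P →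
  ∀ (F : Type u) [NormedAddCommGroup F] [NormedSpace ℝ F] [CompleteSpace F]
    (n : ℕ) (x : Fin n → F),
    eLpNorm (fun ω => ∑ j : Fin n, r j ω • x j) (ENNReal.ofReal q) P ≤
      ENNReal.ofReal K * eLpNorm (fun ω => ∑ j : Fin n, r j ω • x j) (ENNReal.ofReal p) P

/-- The Kahane–Khintchine constant `K_{q,p}`: the smallest admissible constant. -/
def kahaneKhintchineConst (q p : ℝ) : ℝ := sInf {K : ℝ | IsKahaneKhintchineBound.{u, w} q p K}

/-- `τ ∈ (0,∞)` is admissible in the type `p` inequality of the Banach space `F`. -/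
def IsTypeBound (F : Type u) [NormedAddCommGroup F] [NormedSpace ℝ F] (p τ : ℝ) : Prop :=
  0 < τ ∧
  ∀ (Ω : Type w) [MeasurableSpace Ω] (P : Measure Ω) [IsProbabilityMeasure P] [P.IsComplete]
    (r : ℕ → Ω → ℝ), IsRademacherFamily r P →
  ∀ (n : ℕ) (x : Fin n → F),
    eLpNorm (fun ω => ∑ j : Fin n, r j ω • x j) (ENNReal.ofReal p) P ≤
      ENNReal.ofReal (τ * (∑ j : Fin n, ‖x j‖ ^ p) ^ (1 / p))

/-- `F` is of (Rademacher) type `p`. -/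
def HasRademacherType (F : Type u) [NormedAddCommGroup F] [NormedSpace ℝ F] (p : ℝ) : Prop :=
  ∃ τ : ℝ, IsTypeBound.{u, w} F p τ

/-- The type `p` constant `τ_p(F)`: the smallest admissible constant. -/
def typeConst (F : Type u) [NormedAddCommGroup F] [NormedSpace ℝ F] (p : ℝ) : ℝ :=
  sInf {τ : ℝ | IsTypeBound.{u, w} F p τ}

/-- `B ∈ (0,∞)` is admissible in the upper classical (real) Khintchine inequality
`‖∑ r_j a_j‖_{L_q} ≤ B (∑ a_j²)^{1/2}`. -/
def IsKhintchineUpperBound (q B : ℝ) : Prop :=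
  0 < B ∧
  ∀ (Ω : Type w) [MeasurableSpace Ω] (P : Measure Ω) [IsProbabilityMeasure P] [P.IsComplete]
    (r : ℕ → Ω → ℝ), IsRademacherFamily r P →
  ∀ (n : ℕ) (a : Fin n → ℝ),
    eLpNorm (fun ω => ∑ j : Fin n, r j ω * a j) (ENNReal.ofReal q) P ≤
      ENNReal.ofReal (B * Real.sqrt (∑ j : Fin n, a j ^ 2))

/-- The constant `B_q` of the classical Khintchine inequality: the smallest admissible one. -/
def khintchineConst (q : ℝ) : ℝ := sInf {B : ℝ | IsKhintchineUpperBound.{w} q B}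

/-! ### Injective tensor products

Mathlib's `PiTensorProduct` carries a norm instance of its own, which is not the injective tensor
norm; the algebraic tensor products are therefore wrapped in new type names. -/

section Tensor

variable (k : ℕ) (E : Type u) [NormedAddCommGroup E] [NormedSpace ℝ E]

variable {k E} in
/-- The linear functional `f_1 ⊗ ⋯ ⊗ f_k` on the `k`-fold algebraic tensor product. -/
def dualTensor (f : Fin k → StrongDual ℝ E) : (⨂[ℝ] _ : Fin k, E) →ₗ[ℝ] ℝ :=
  PiTensorProduct.lift
    ((MultilinearMap.mkPiAlgebra ℝ (Fin k) ℝ).compLinearMap fun i => (f i : E →ₗ[ℝ] ℝ))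

variable {k E} in
theorem dualTensor_tprod (f : Fin k → StrongDual ℝ E) (x : Fin k → E) :
    dualTensor f (PiTensorProduct.tprod ℝ x) = ∏ i, f i (x i) := by
  simp [dualTensor]

variable {k E} in
theorem dualTensor_bdd (U : ⨂[ℝ] _ : Fin k, E) :
    ∃ C : ℝ, ∀ f : Fin k → StrongDual ℝ E, (∀ i, ‖f i‖ ≤ 1) → |dualTensor f U| ≤ C := by
  induction U using PiTensorProduct.induction_on with
  | smul_tprod c x =>
    refine ⟨|c| * ∏ i, ‖x i‖, fun f hf => ?_⟩
    rw [map_smul, dualTensor_tprod, smul_eq_mul, abs_mul, Finset.abs_prod]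
    gcongr with i
    simpa using (f i).le_of_opNorm_le (hf i) (x i)
  | add U V hU hV =>
    obtain ⟨C, hC⟩ := hU
    obtain ⟨D, hD⟩ := hV
    refine ⟨C + D, fun f hf => ?_⟩
    rw [map_add]
    exact (abs_add_le _ _).trans (add_le_add (hC f hf) (hD f hf))

/-- The `k`-fold algebraic tensor product of `E`, to be normed by the injective tensor norm. -/
def AlgTensor : Type u := ⨂[ℝ] _ : Fin k, E

instance : AddCommGroup (AlgTensor k E) := inferInstanceAs (AddCommGroup (⨂[ℝ] _ : Fin k, E))

instance : Module ℝ (AlgTensor k E) := inferInstanceAs (Module ℝ (⨂[ℝ] _ : Fin k, E))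

/-- The injective tensor norm `‖U‖_ε = sup {|⟨f_1 ⊗ ⋯ ⊗ f_k, U⟩| : f_1, …, f_k ∈ B_{E'}}`. -/
instance : Norm (AlgTensor k E) where
  norm U := ⨆ f : {f : Fin k → StrongDual ℝ E // ∀ i, ‖f i‖ ≤ 1}, |dualTensor f.1 U|

variable {k E} in
theorem AlgTensor.le_norm (U : AlgTensor k E) (f : Fin k → StrongDual ℝ E)
    (hf : ∀ i, ‖f i‖ ≤ 1) : |dualTensor f U| ≤ ‖U‖ := by
  obtain ⟨C, hC⟩ := dualTensor_bdd (k := k) (E := E) U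
  exact le_ciSup (f := fun f : {f : Fin k → StrongDual ℝ E // ∀ i, ‖f i‖ ≤ 1} =>
    |dualTensor f.1 U|) ⟨C, by rintro _ ⟨g, rfl⟩; exact hC g.1 g.2⟩ ⟨f, hf⟩

variable {k E} in
theorem AlgTensor.norm_le (U : AlgTensor k E) (C : ℝ)
    (h : ∀ f : Fin k → StrongDual ℝ E, (∀ i, ‖f i‖ ≤ 1) → |dualTensor f U| ≤ C) : ‖U‖ ≤ C := by
  have : Nonempty {f : Fin k → StrongDual ℝ E // ∀ i, ‖f i‖ ≤ 1} := ⟨⟨0, by simp⟩⟩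
  exact ciSup_le fun f => h f.1 f.2

theorem AlgTensor.core : SeminormedSpace.Core ℝ (AlgTensor k E) where
  norm_nonneg U := Real.iSup_nonneg fun _ => abs_nonneg _
  norm_smul c U := by
    change (⨆ f : {f : Fin k → StrongDual ℝ E // ∀ i, ‖f i‖ ≤ 1},
      |dualTensor f.1 (c • (U : ⨂[ℝ] _ : Fin k, E))|) = ‖c‖ * ⨆ f, _
    rw [Real.mul_iSup_of_nonneg (norm_nonneg c)]
    refine iSup_congr fun f => ?_
    exact (congrArg _ ((dualTensor f.1).map_smul c U)).trans (abs_mul _ _)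
  norm_triangle U V := by
    refine AlgTensor.norm_le _ _ fun f hf => ?_
    refine le_trans (le_of_eq_of_le ?_ (abs_add_le (dualTensor f U) (dualTensor f V)))
      (add_le_add (U.le_norm f hf) (V.le_norm f hf))
    exact congrArg _ (map_add (dualTensor f) _ _)

instance : SeminormedAddCommGroup (AlgTensor k E) :=
  SeminormedAddCommGroup.ofCore (AlgTensor.core k E)

instance : NormedSpace ℝ (AlgTensor k E) where
  norm_smul_le c U := ((AlgTensor.core k E).norm_smul c U).le

/-- The `k`-fold injective tensor product `⊗^k_ε E`: the completion of the algebraic one. -/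
abbrev InjTensor : Type u := UniformSpace.Completion (AlgTensor k E)

variable {E} in
/-- The tensor power `⊗^k x = x ⊗ ⋯ ⊗ x` in the algebraic tensor product. -/
def AlgTensor.pow (x : E) : AlgTensor k E := PiTensorProduct.tprod ℝ (fun _ : Fin k => x)

variable {E} in
/-- The tensor power `⊗^k x = x ⊗ ⋯ ⊗ x` as an element of `⊗^k_ε E`. -/
def tensorPow (x : E) : InjTensor k E := (AlgTensor.pow k x : InjTensor k E)

/-- The symmetrization operator on the `k`-fold algebraic tensor product,
see `symmetrize_tprod`. -/
def symmetrize : (⨂[ℝ] _ : Fin k, E) →ₗ[ℝ] (⨂[ℝ] _ : Fin k, E) :=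
  ((k ! : ℝ)⁻¹) • ∑ σ : Equiv.Perm (Fin k),
    ((PiTensorProduct.reindex ℝ (fun _ : Fin k => E) σ.symm).toLinearMap :
      (⨂[ℝ] _ : Fin k, E) →ₗ[ℝ] (⨂[ℝ] _ : Fin k, E))

variable {k E} in
theorem symmetrize_tprod (x : Fin k → E) :
    symmetrize k E (PiTensorProduct.tprod ℝ x) =
      ((k ! : ℝ)⁻¹) • ∑ σ : Equiv.Perm (Fin k), PiTensorProduct.tprod ℝ (fun i => x (σ i)) := by
  simp [symmetrize, LinearMap.sum_apply]

/-- The `k`-fold symmetric algebraic tensor product, as a subspace of the full one: the linear span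
of the symmetrizations of elementary tensors. -/
def symSubmodule : Submodule ℝ (⨂[ℝ] _ : Fin k, E) :=
  Submodule.span ℝ (Set.range fun x : Fin k → E => symmetrize k E (PiTensorProduct.tprod ℝ x))

variable {E} in
theorem tprod_const_mem (x : E) :
    PiTensorProduct.tprod ℝ (fun _ : Fin k => x) ∈ symSubmodule k E := by
  have h : symmetrize k E (PiTensorProduct.tprod ℝ (fun _ : Fin k => x)) =
      PiTensorProduct.tprod ℝ (fun _ : Fin k => x) := by
    rw [symmetrize_tprod, Finset.sum_const, Finset.card_univ, Fintype.card_perm, Fintype.card_fin,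
      ← Nat.cast_smul_eq_nsmul ℝ, smul_smul, inv_mul_cancel₀ (by positivity), one_smul]
  rw [← h]
  exact Submodule.subset_span ⟨_, rfl⟩

theorem symmetrize_mem (U : ⨂[ℝ] _ : Fin k, E) : symmetrize k E U ∈ symSubmodule k E := by
  induction U using PiTensorProduct.induction_on with
  | smul_tprod c x =>
    rw [map_smul]
    exact Submodule.smul_mem _ _ (Submodule.subset_span ⟨x, rfl⟩)
  | add U V hU hV =>
    rw [map_add]
    exact Submodule.add_mem _ hU hV

variable {k E} in
theorem dualTensor_const_symmetrize (f : StrongDual ℝ E) (U : ⨂[ℝ] _ : Fin k, E) :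
    dualTensor (fun _ => f) (symmetrize k E U) = dualTensor (fun _ => f) U := by
  induction U using PiTensorProduct.induction_on with
  | smul_tprod c x =>
    have h : ∀ σ : Equiv.Perm (Fin k), ∏ i, f (x (σ i)) = ∏ i, f (x i) :=
      fun σ => Equiv.prod_comp σ fun i => f (x i)
    simp only [map_smul, symmetrize_tprod, map_sum, dualTensor_tprod, h, Finset.sum_const,
      Finset.card_univ, Fintype.card_perm, Fintype.card_fin]
    rw [← Nat.cast_smul_eq_nsmul ℝ, smul_smul ((k ! : ℝ)⁻¹), inv_mul_cancel₀ (by positivity),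
      one_smul]
  | add U V hU hV => rw [map_add, map_add, map_add, hU, hV]

/-- The `k`-fold symmetric algebraic tensor product of `E`, to be normed by the symmetric injective
tensor norm. -/
def SymAlgTensor : Type u := symSubmodule k E

instance : AddCommGroup (SymAlgTensor k E) := inferInstanceAs (AddCommGroup (symSubmodule k E))

instance : Module ℝ (SymAlgTensor k E) := inferInstanceAs (Module ℝ (symSubmodule k E))

/-- The inclusion of the symmetric into the full algebraic tensor product. -/
def symIncl : SymAlgTensor k E →ₗ[ℝ] AlgTensor k E := (symSubmodule k E).subtype

/-- The symmetric injective tensor norm `‖U‖_{ε_s} = sup {|⟨f ⊗ ⋯ ⊗ f, U⟩| : f ∈ B_{E'}}`;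
here `⟨f ⊗ ⋯ ⊗ f, U⟩ = ∑ λ_j f(x_j)^k` if `U = ∑ λ_j ⊗^k x_j`, see `dualTensor_tprod`. -/
instance : Norm (SymAlgTensor k E) where
  norm U := ⨆ f : {f : StrongDual ℝ E // ‖f‖ ≤ 1}, |dualTensor (fun _ => f.1) (symIncl k E U)|

variable {k E} in
theorem SymAlgTensor.le_norm (U : SymAlgTensor k E) (f : StrongDual ℝ E) (hf : ‖f‖ ≤ 1) :
    |dualTensor (fun _ => f) (symIncl k E U)| ≤ ‖U‖ := by
  obtain ⟨C, hC⟩ := dualTensor_bdd (k := k) (E := E) (symIncl k E U)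
  exact le_ciSup (f := fun f : {f : StrongDual ℝ E // ‖f‖ ≤ 1} =>
    |dualTensor (fun _ => f.1) (symIncl k E U)|)
    ⟨C, by rintro _ ⟨g, rfl⟩; exact hC _ fun _ => g.2⟩ ⟨f, hf⟩

variable {k E} in
theorem SymAlgTensor.norm_le (U : SymAlgTensor k E) (C : ℝ)
    (h : ∀ f : StrongDual ℝ E, ‖f‖ ≤ 1 → |dualTensor (fun _ => f) (symIncl k E U)| ≤ C) :
    ‖U‖ ≤ C := by
  have : Nonempty {f : StrongDual ℝ E // ‖f‖ ≤ 1} := ⟨⟨0, by simp⟩⟩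
  exact ciSup_le fun f => h f.1 f.2

theorem SymAlgTensor.core : SeminormedSpace.Core ℝ (SymAlgTensor k E) where
  norm_nonneg U := Real.iSup_nonneg fun _ => abs_nonneg _
  norm_smul c U := by
    change (⨆ f : {f : StrongDual ℝ E // ‖f‖ ≤ 1},
      |dualTensor (fun _ => f.1) (c • (symIncl k E U : ⨂[ℝ] _ : Fin k, E))|) = ‖c‖ * ⨆ f, _
    rw [Real.mul_iSup_of_nonneg (norm_nonneg c)]
    refine iSup_congr fun f => ?_
    exact (congrArg _ ((dualTensor fun _ => f.1).map_smul c (symIncl k E U))).trans (abs_mul _ _)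
  norm_triangle U V := by
    refine SymAlgTensor.norm_le _ _ fun f hf => ?_
    refine le_trans (le_of_eq_of_le ?_ (abs_add_le (dualTensor (fun _ => f) (symIncl k E U))
      (dualTensor (fun _ => f) (symIncl k E V))))
      (add_le_add (U.le_norm f hf) (V.le_norm f hf))
    exact congrArg _ (map_add (dualTensor fun _ => f) _ _)

instance : SeminormedAddCommGroup (SymAlgTensor k E) :=
  SeminormedAddCommGroup.ofCore (SymAlgTensor.core k E)

instance : NormedSpace ℝ (SymAlgTensor k E) where
  norm_smul_le c U := ((SymAlgTensor.core k E).norm_smul c U).le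

/-- The `k`-fold symmetric injective tensor product `⊗^{k,s}_{ε_s} E`: the completion of the
symmetric algebraic one. -/
abbrev SymInjTensor : Type u := UniformSpace.Completion (SymAlgTensor k E)

variable {E} in
/-- The tensor power `⊗^k x = x ⊗ ⋯ ⊗ x` in the symmetric algebraic tensor product. -/
def SymAlgTensor.pow (x : E) : SymAlgTensor k E :=
  (⟨PiTensorProduct.tprod ℝ (fun _ : Fin k => x), tprod_const_mem k x⟩ : symSubmodule k E)

variable {E} in
/-- The tensor power `⊗^k x = x ⊗ ⋯ ⊗ x` as an element of `⊗^{k,s}_{ε_s} E`. -/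
def symTensorPow (x : E) : SymInjTensor k E := (SymAlgTensor.pow k x : SymInjTensor k E)

/-- The symmetrization as a linear map onto the symmetric algebraic tensor product. -/
def symProjAlgₗ : AlgTensor k E →ₗ[ℝ] SymAlgTensor k E :=
  (symmetrize k E).codRestrict (symSubmodule k E) (symmetrize_mem k E)

/-- The symmetrization is a contraction for the norms `‖·‖_ε` and `‖·‖_{ε_s}`. -/
theorem norm_symProjAlgₗ_le (U : AlgTensor k E) : ‖symProjAlgₗ k E U‖ ≤ 1 * ‖U‖ := by
  rw [one_mul]
  refine SymAlgTensor.norm_le _ _ fun f hf => ?_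
  refine le_of_eq_of_le (congrArg _ ?_) (U.le_norm (fun _ => f) fun _ => hf)
  exact dualTensor_const_symmetrize f U

/-- The continuous extension `s_ε : ⊗^k_ε E → ⊗^{k,s}_{ε_s} E` of the symmetrization; on (limits of)
symmetric tensors it is the identification of the symmetric part of `⊗^k_ε E` with
`⊗^{k,s}_{ε_s} E`. -/
def symProj : InjTensor k E →L[ℝ] SymInjTensor k E :=
  ((symProjAlgₗ k E).mkContinuous 1 (norm_symProjAlgₗ_le k E)).completion

/-- The closed subspace of symmetric elements of `⊗^k_ε E`: the closure of the symmetric algebraic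
tensors. -/
def symPart : Set (InjTensor k E) :=
  closure (Set.range fun U : SymAlgTensor k E => (symIncl k E U : InjTensor k E))

variable {E} in
/-- The injective `k`-th moment `M^k_ε[ξ] = 𝔼[⊗^k ξ]`, a Bochner integral in `⊗^k_ε E`. -/
def injMoment {Ω : Type v} [MeasurableSpace Ω] (ξ : Ω → E) (P : Measure Ω) : InjTensor k E :=
  ∫ ω, tensorPow k (ξ ω) ∂P

end Tensor

end MonteCarloMoments

end

open MonteCarloMoments

/-!
Symmetrization bounds the error by twice the `L_q` norm of the Rademacher sums `∑ j, ε j ⊗^k ξ_j`.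
For fixed vectors `x_j`, the symmetric injective norm of `∑ j, ε j ⊗^k x_j` is the supremum of
`|∑ j, ε j f(x_j)^k|` over the dual unit ball, and `t ↦ t^k` is Lipschitz with constant
`k ‖x_j‖^(k-1)` on `[-‖x_j‖, ‖x_j‖]`; hence Talagrand's contraction principle compares these sums
with the linear ones `∑ j, ε j k ‖x_j‖^(k-1) x_j`, at the price of a factor `2`. To the latter the
Kahane–Khintchine inequality and the type `p` inequality of `E` apply, and they leave
`(∑ j, ‖ξ_j‖^(k p))^(1/p)`, whose `L_q` norm is controlled by the triangle inequality in `L_{q/p}`.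

Every average over a Rademacher family is computed as an average over the finite group of signs.
That `K_{q,p}` is finite is part of what has to be shown, since an empty infimum of reals is `0`; it
follows by iterating a hypercontractive inequality between the moments of order `2^m` and `2^(m+1)`.
-/

namespace MonteCarloMoments

open scoped BigOperators

section Signs

variable {n : ℕ}

theorem expect_signs_succ (η : (Fin (n + 1) → ℤˣ) → ℝ) :
    𝔼 ε, η ε = 𝔼 ε : Fin n → ℤˣ, (η (Fin.cons 1 ε) + η (Fin.cons (-1) ε)) / 2 := by
  calc 𝔼 ε, η ε = 𝔼 s : ℤˣ × (Fin n → ℤˣ), η (Fin.cons s.1 s.2) :=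
        (Fintype.expect_equiv (Fin.consEquiv fun _ => ℤˣ) _ _ fun _ => rfl).symm
    _ = 𝔼 ε : Fin n → ℤˣ, 𝔼 s : ℤˣ, η (Fin.cons s ε) := by
        rw [← Finset.univ_product_univ, Finset.expect_product, Finset.expect_comm]
    _ = _ := Finset.expect_congr rfl fun ε _ => by
        rw [Fintype.expect_eq_sum_div_card]
        simp [UnitsInt.univ]

theorem expect_signs_neg (η : (Fin n → ℤˣ) → ℝ) : 𝔼 ε, η (-ε) = 𝔼 ε, η ε :=
  Fintype.expect_equiv (Equiv.neg _) _ _ fun _ => rfl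

theorem sum_cons_smul {V : Type*} [AddCommGroup V] (s : ℤˣ) (ε : Fin n → ℤˣ)
    (x : Fin (n + 1) → V) :
    ∑ j, (Fin.cons s ε : Fin (n + 1) → ℤˣ) j • x j = ∑ j, ε j • x j.succ + s • x 0 := by
  simp only [Fin.sum_univ_succ, Fin.cons_zero, Fin.cons_succ, add_comm]

theorem sum_neg_smul {V : Type*} [AddCommGroup V] (ε : Fin n → ℤˣ) (x : Fin n → V) :
    ∑ j, (-ε) j • x j = -∑ j, ε j • x j := by
  simp only [Pi.neg_apply, Units.smul_def, Units.val_neg, neg_smul, Finset.sum_neg_distrib]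

end Signs

section Contraction

open BoundedContinuousFunction

variable {T : Type*} [TopologicalSpace T] [Nonempty T] {G : ℝ → ℝ}

/- This is the case of two points in Tomić's inequality: `(x, y)` is weakly majorized by
`(u, v)`. -/
theorem add_le_add_of_weakly_majorized (hG : ConvexOn ℝ Set.univ G) (hmono : Monotone G)
    {x y u v : ℝ} (hx : x ≤ max u v) (hy : y ≤ max u v) (hxy : x + y ≤ u + v) :
    G x + G y ≤ G u + G v := by
  wlog huv : u ≤ v generalizing u v
  · rw [add_comm (G u)]
    exact this (max_comm u v ▸ hx) (max_comm u v ▸ hy) (add_comm u v ▸ hxy) (le_of_not_ge huv)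
  wlog hyx : y ≤ x generalizing x y
  · rw [add_comm (G x)]
    exact this hy hx (add_comm x y ▸ hxy) (le_of_not_ge hyx)
  rw [max_eq_right huv] at hx hy
  obtain hyu | hyu := le_total y u
  · rw [add_comm (G u)]
    exact add_le_add (hmono hx) (hmono hyu)
  obtain ⟨a, b, ha, hb, hab, rfl⟩ : y ∈ segment ℝ u v := by
    rw [segment_eq_Icc huv]
    exact ⟨hyu, hy⟩
  simp only [smul_eq_mul] at hxy ⊢
  have hreflect : x ≤ b * u + a * v := by
    linear_combination hxy - (u + v) * hab
  calc G x + G (a * u + b * v)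
      ≤ (b * G u + a * G v) + (a * G u + b * G v) :=
        add_le_add ((hmono hreflect).trans
          (hG.2 (Set.mem_univ _) (Set.mem_univ _) hb ha (by rwa [add_comm])))
          (hG.2 (Set.mem_univ _) (Set.mem_univ _) ha hb hab)
    _ = G u + G v := by linear_combination (G u + G v) * hab

theorem convex_iSup_add_le (hG : ConvexOn ℝ Set.univ G) (hmono : Monotone G) (h a b : T →ᵇ ℝ)
    (hab : ∀ t, |a t| ≤ |b t|) (hab' : ∀ s t, |a s - a t| ≤ |b s - b t|) :
    G (⨆ t, (h + a) t) + G (⨆ t, (h - a) t) ≤ G (⨆ t, (h + b) t) + G (⨆ t, (h - b) t) := by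
  have hle (f : T →ᵇ ℝ) (t : T) : f t ≤ ⨆ t, f t := le_ciSup f.isBounded_range.bddAbove t
  have hadd (t : T) : h t + b t ≤ ⨆ t, (h + b) t := hle (h + b) t
  have hsub (t : T) : h t - b t ≤ ⨆ t, (h - b) t := hle (h - b) t
  have habs (t : T) : h t + |b t| ≤ max (⨆ t, (h + b) t) (⨆ t, (h - b) t) := by
    rcases abs_cases (b t) with ⟨hb, -⟩ | ⟨hb, -⟩ <;> rw [hb]
    · exact (hadd t).trans (le_max_left _ _)
    · exact (hsub t).trans (le_max_right _ _)
  refine add_le_add_of_weakly_majorized hG hmono (ciSup_le fun t => ?_) (ciSup_le fun t => ?_) ?_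
  · exact (add_le_add_right ((le_abs_self _).trans (hab t)) _).trans (habs t)
  · exact (add_le_add_right ((neg_le_abs _).trans (hab t)) _).trans (habs t)
  · rw [← le_sub_iff_add_le]
    refine ciSup_le fun s => ?_
    rw [le_sub_comm]
    refine ciSup_le fun t => ?_
    rw [le_sub_iff_add_le', coe_add, coe_sub, Pi.add_apply, Pi.sub_apply]
    have hst := (le_abs_self _).trans (hab' s t)
    rcases abs_cases (b s - b t) with ⟨hb, -⟩ | ⟨hb, -⟩ <;>
      linarith [hadd s, hadd t, hsub s, hsub t]

theorem expect_convex_iSup_signs_le (hG : ConvexOn ℝ Set.univ G) (hmono : Monotone G) {n : ℕ}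
    (h : T →ᵇ ℝ) (a b : Fin n → T →ᵇ ℝ) (hab : ∀ j t, |a j t| ≤ |b j t|)
    (hab' : ∀ j s t, |a j s - a j t| ≤ |b j s - b j t|) :
    𝔼 ε : Fin n → ℤˣ, G (⨆ t, (h + ∑ j, ε j • a j) t) ≤
      𝔼 ε : Fin n → ℤˣ, G (⨆ t, (h + ∑ j, ε j • b j) t) := by
  induction n generalizing h with
  | zero => simp only [Finset.univ_eq_empty, Finset.sum_empty, le_refl]
  | succ n ih =>
    have hstep (ε : Fin n → ℤˣ) := convex_iSup_add_le hG hmono (h + ∑ j, ε j • a j.succ) (a 0)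
      (b 0) (hab 0) (hab' 0)
    have ih' (h : T →ᵇ ℝ) := ih h (fun j => a j.succ) (fun j => b j.succ)
      (fun j => hab j.succ) fun j => hab' j.succ
    simp only [expect_signs_succ, sum_cons_smul, Units.neg_smul, one_smul, ← Finset.expect_div,
      ← add_assoc, ← sub_eq_add_neg, ← add_sub_assoc]
    gcongr ?_ / 2
    refine (Finset.expect_le_expect fun ε _ => hstep ε).trans ?_
    simp only [Finset.expect_add_distrib, add_sub_right_comm, add_right_comm h]
    exact add_le_add (ih' (h + b 0)) (ih' (h - b 0))

theorem convexOn_max_zero_rpow {q : ℝ} (hq : 1 ≤ q) :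
    ConvexOn ℝ Set.univ fun x : ℝ => max x 0 ^ q := by
  have hmax : ConvexOn ℝ Set.univ fun x : ℝ => max x 0 :=
    (convexOn_id convex_univ).sup (convexOn_const 0 convex_univ)
  refine ⟨convex_univ, fun x _ y _ a b ha hb hab => ?_⟩
  exact (Real.rpow_le_rpow (le_max_right _ _) (hmax.2 trivial trivial ha hb hab)
    (zero_le_one.trans hq)).trans
      ((convexOn_rpow hq).2 (le_max_right x 0) (le_max_right y 0) ha hb hab)

theorem norm_rpow_le_max_iSup_rpow {q : ℝ} (hq : 0 ≤ q) (f : T →ᵇ ℝ) :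
    ‖f‖ ^ q ≤ max (⨆ t, f t) 0 ^ q + max (⨆ t, (-f) t) 0 ^ q := by
  have hf : ‖f‖ ≤ max (⨆ t, f t) (⨆ t, (-f) t) := norm_le_of_nonempty.2 fun t => by
    rw [Real.norm_eq_abs, abs_eq_max_neg]
    exact max_le_max (le_ciSup f.isBounded_range.bddAbove t)
      (le_ciSup (-f).isBounded_range.bddAbove t)
  rcases le_max_iff.1 hf with hf | hf
  · exact le_add_of_le_of_nonneg
      (Real.rpow_le_rpow (norm_nonneg f) (hf.trans (le_max_left _ _)) hq) (by positivity)
  · exact le_add_of_nonneg_of_le (by positivity)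
      (Real.rpow_le_rpow (norm_nonneg f) (hf.trans (le_max_left _ _)) hq)

theorem max_iSup_rpow_le_norm_rpow {q : ℝ} (hq : 0 ≤ q) (f : T →ᵇ ℝ) :
    max (⨆ t, f t) 0 ^ q ≤ ‖f‖ ^ q :=
  Real.rpow_le_rpow (le_max_right _ _)
    (max_le (ciSup_le fun t => (le_abs_self _).trans (f.norm_coe_le_norm t)) (norm_nonneg f)) hq

theorem expect_norm_signs_le_of_contraction {q : ℝ} (hq : 1 ≤ q) {n : ℕ} (a b : Fin n → T →ᵇ ℝ)
    (hab : ∀ j t, |a j t| ≤ |b j t|) (hab' : ∀ j s t, |a j s - a j t| ≤ |b j s - b j t|) :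
    𝔼 ε : Fin n → ℤˣ, ‖∑ j, ε j • a j‖ ^ q ≤ 2 * 𝔼 ε : Fin n → ℤˣ, ‖∑ j, ε j • b j‖ ^ q := by
  have hq₀ : 0 ≤ q := zero_le_one.trans hq
  set G : ℝ → ℝ := fun x => max x 0 ^ q
  have hmono : Monotone G := fun x y hxy =>
    Real.rpow_le_rpow (le_max_right x 0) (max_le_max_right 0 hxy) hq₀
  calc 𝔼 ε : Fin n → ℤˣ, ‖∑ j, ε j • a j‖ ^ q
      ≤ 𝔼 ε : Fin n → ℤˣ, (G (⨆ t, (∑ j, ε j • a j) t) + G (⨆ t, (∑ j, (-ε) j • a j) t)) := by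
        simp only [sum_neg_smul]
        exact Finset.expect_le_expect fun ε _ => norm_rpow_le_max_iSup_rpow hq₀ _
    _ = 2 * 𝔼 ε : Fin n → ℤˣ, G (⨆ t, (∑ j, ε j • a j) t) := by
        rw [Finset.expect_add_distrib, two_mul,
          expect_signs_neg fun ε => G (⨆ t, (∑ j, ε j • a j) t)]
    _ ≤ 2 * 𝔼 ε : Fin n → ℤˣ, G (⨆ t, (∑ j, ε j • b j) t) := by
        have := expect_convex_iSup_signs_le (convexOn_max_zero_rpow hq) hmono 0 a b hab hab'
        simp only [zero_add] at this
        exact mul_le_mul_of_nonneg_left this zero_le_two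
    _ ≤ 2 * 𝔼 ε : Fin n → ℤˣ, ‖∑ j, ε j • b j‖ ^ q :=
        mul_le_mul_of_nonneg_left (Finset.expect_le_expect fun ε _ =>
          max_iSup_rpow_le_norm_rpow hq₀ _) zero_le_two

end Contraction

section Kahane

section Fintype

variable {ι : Type*} [Fintype ι]

theorem expect_add_sq_le_add_sq {f g : ι → ℝ} {A B : ℝ} (hA : 0 ≤ A) (hB : 0 ≤ B)
    (hf : 𝔼 i, f i ^ 2 ≤ A ^ 2) (hg : 𝔼 i, g i ^ 2 ≤ B ^ 2) :
    𝔼 i, (f i + g i) ^ 2 ≤ (A + B) ^ 2 := by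
  have hfg : 𝔼 i, f i * g i ≤ A * B := by
    refine le_of_sq_le_sq ?_ (mul_nonneg hA hB)
    calc (𝔼 i, f i * g i) ^ 2 ≤ (𝔼 i, f i ^ 2) * 𝔼 i, g i ^ 2 :=
          Finset.expect_mul_sq_le_sq_mul_sq _ f g
      _ ≤ A ^ 2 * B ^ 2 :=
          mul_le_mul hf hg (Finset.expect_nonneg fun i _ => sq_nonneg _) (sq_nonneg A)
      _ = (A * B) ^ 2 := (mul_pow A B 2).symm
  simp only [add_sq, Finset.expect_add_distrib, mul_assoc, ← Finset.mul_expect]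
  gcongr

theorem expect_sq_le_of_sq_le_mul {f g h : ι → ℝ} (hg : ∀ i, 0 ≤ g i) (hh : ∀ i, 0 ≤ h i)
    (hf : ∀ i, f i ^ 2 ≤ g i * h i) : (𝔼 i, f i) ^ 2 ≤ (𝔼 i, g i) * 𝔼 i, h i := by
  simp only [Fintype.expect_eq_sum_div_card, div_pow, div_mul_div_comm, ← sq]
  gcongr
  exact Finset.sum_sq_le_sum_mul_sum_of_sq_le_mul _ (fun i _ => hg i) (fun i _ => hh i)
    fun i _ => hf i

theorem expect_sq_pow_three_le {g : ι → ℝ} (hg : ∀ i, 0 ≤ g i) :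
    (𝔼 i, g i ^ 2) ^ 3 ≤ (𝔼 i, g i) ^ 2 * 𝔼 i, g i ^ 4 := by
  have h₂ : (𝔼 i, g i ^ 2) ^ 2 ≤ (𝔼 i, g i) * 𝔼 i, g i ^ 3 :=
    expect_sq_le_of_sq_le_mul hg (fun i => pow_nonneg (hg i) 3) fun i => le_of_eq (by ring)
  have h₃ : (𝔼 i, g i ^ 3) ^ 2 ≤ (𝔼 i, g i ^ 2) * 𝔼 i, g i ^ 4 :=
    expect_sq_le_of_sq_le_mul (fun i => pow_nonneg (hg i) 2) (fun i => pow_nonneg (hg i) 4)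
      fun i => le_of_eq (by ring)
  have h₀ : 0 ≤ 𝔼 i, g i ^ 2 := Finset.expect_nonneg fun i _ => pow_nonneg (hg i) 2
  obtain h | h := h₀.eq_or_lt
  · rw [← h, zero_pow three_ne_zero]
    exact mul_nonneg (sq_nonneg _) (Finset.expect_nonneg fun i _ => pow_nonneg (hg i) 4)
  refine le_of_mul_le_mul_left ?_ h
  calc (𝔼 i, g i ^ 2) * (𝔼 i, g i ^ 2) ^ 3 = ((𝔼 i, g i ^ 2) ^ 2) ^ 2 := by ring
    _ ≤ ((𝔼 i, g i) * 𝔼 i, g i ^ 3) ^ 2 := pow_le_pow_left₀ (sq_nonneg _) h₂ 2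
    _ ≤ (𝔼 i, g i) ^ 2 * ((𝔼 i, g i ^ 2) * 𝔼 i, g i ^ 4) := by
        rw [mul_pow]
        exact mul_le_mul_of_nonneg_left h₃ (sq_nonneg _)
    _ = (𝔼 i, g i ^ 2) * ((𝔼 i, g i) ^ 2 * 𝔼 i, g i ^ 4) := by ring

end Fintype

theorem convex_pow_four_add_pow_four_le {V : Type*} [AddCommGroup V] [Module ℝ V] {N : V → ℝ}
    (hN : ConvexOn ℝ Set.univ N) (hN₀ : ∀ v, 0 ≤ N v) (u v : V) :
    N ((3 / 4 : ℝ) • u + (1 / 4 : ℝ) • v) ^ 4 + N ((1 / 4 : ℝ) • u + (3 / 4 : ℝ) • v) ^ 4 ≤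
      (N u ^ 2 + N v ^ 2) ^ 2 / 2 := by
  have h₁ : N ((3 / 4 : ℝ) • u + (1 / 4 : ℝ) • v) ≤ 3 / 4 * N u + 1 / 4 * N v :=
    hN.2 trivial trivial (by norm_num) (by norm_num) (by norm_num)
  have h₂ : N ((1 / 4 : ℝ) • u + (3 / 4 : ℝ) • v) ≤ 1 / 4 * N u + 3 / 4 * N v :=
    hN.2 trivial trivial (by norm_num) (by norm_num) (by norm_num)
  refine (add_le_add (pow_le_pow_left₀ (hN₀ _) h₁ 4) (pow_le_pow_left₀ (hN₀ _) h₂ 4)).trans ?_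
  nlinarith [sq_nonneg (N u ^ 2 - N v ^ 2), sq_nonneg ((N u - N v) ^ 2)]

/- Hypercontractivity of the noise operator at the exponents `2` and `4`. The induction step rests
on `y + (s ± x) / 2 = 3 / 4 • (y + s / 2 ± x) + 1 / 4 • (y + s / 2 ∓ x)`. -/
theorem expect_convex_signs_pow_four_le {V : Type*} [AddCommGroup V] [Module ℝ V] {N : V → ℝ}
    (hN : ConvexOn ℝ Set.univ N) (hN₀ : ∀ v, 0 ≤ N v) {n : ℕ} (y : V) (x : Fin n → V) :
    𝔼 ε : Fin n → ℤˣ, N (y + (1 / 2 : ℝ) • ∑ j, ε j • x j) ^ 4 ≤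
      (𝔼 ε : Fin n → ℤˣ, N (y + ∑ j, ε j • x j) ^ 2) ^ 2 := by
  induction n generalizing y with
  | zero => simp [← pow_mul]
  | succ n ih =>
    set f : V → (Fin n → ℤˣ) → ℝ := fun z ε => N (z + (1 / 2 : ℝ) • ∑ j, ε j • x j.succ) ^ 2
    set A : V → ℝ := fun z => 𝔼 ε : Fin n → ℤˣ, N (z + ∑ j, ε j • x j.succ) ^ 2
    have hA (z : V) : 0 ≤ A z := Finset.expect_nonneg fun ε _ => sq_nonneg _
    have hf (z : V) : 𝔼 ε, f z ε ^ 2 ≤ A z ^ 2 := by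
      simpa only [f, ← pow_mul] using ih z fun j => x j.succ
    have hstep (ε : Fin n → ℤˣ) :
        N (y + (1 / 2 : ℝ) • (∑ j, ε j • x j.succ + x 0)) ^ 4 +
          N (y + (1 / 2 : ℝ) • (∑ j, ε j • x j.succ - x 0)) ^ 4 ≤
        (f (y + x 0) ε + f (y - x 0) ε) ^ 2 / 2 := by
      convert convex_pow_four_add_pow_four_le hN hN₀ (y + x 0 + (1 / 2 : ℝ) • ∑ j, ε j • x j.succ)
        (y - x 0 + (1 / 2 : ℝ) • ∑ j, ε j • x j.succ) using 4 <;> module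
    simp only [expect_signs_succ, sum_cons_smul, Units.neg_smul, one_smul, ← Finset.expect_div,
      ← sub_eq_add_neg]
    calc (𝔼 ε : Fin n → ℤˣ, (N (y + (1 / 2 : ℝ) • (∑ j, ε j • x j.succ + x 0)) ^ 4 +
            N (y + (1 / 2 : ℝ) • (∑ j, ε j • x j.succ - x 0)) ^ 4)) / 2
        ≤ (𝔼 ε, (f (y + x 0) ε + f (y - x 0) ε) ^ 2 / 2) / 2 := by
          gcongr with ε
          exact hstep ε
      _ ≤ ((A (y + x 0) + A (y - x 0)) / 2) ^ 2 := by
          rw [← Finset.expect_div, div_div, div_pow]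
          norm_num only
          gcongr
          exact expect_add_sq_le_add_sq (hA _) (hA _) (hf _) (hf _)
      _ = _ := by
          simp only [A, Finset.expect_add_distrib, add_sub, add_sub_right_comm, ← add_assoc,
            add_comm _ (x 0)]

variable {F : Type*} [SeminormedAddCommGroup F] [NormedSpace ℝ F]

theorem expect_norm_signs_pow_le (m : ℕ) {n : ℕ} (x : Fin n → F) :
    𝔼 ε : Fin n → ℤˣ, ‖∑ j, ε j • x j‖ ^ (4 * m) ≤
      2 ^ (4 * m) * (𝔼 ε : Fin n → ℤˣ, ‖∑ j, ε j • x j‖ ^ (2 * m)) ^ 2 := by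
  have h := expect_convex_signs_pow_four_le (N := fun v : F => ‖v‖ ^ m)
    (convexOn_univ_norm.pow (fun _ _ => norm_nonneg _) m) (fun v => by positivity) 0 x
  simp only [zero_add, norm_smul, Real.norm_of_nonneg one_half_pos.le, ← pow_mul, mul_pow,
    ← Finset.mul_expect, mul_comm m] at h
  rwa [one_div, inv_pow, inv_mul_le_iff₀ (by positivity)] at h

theorem expect_norm_signs_sq_le {n : ℕ} (x : Fin n → F) :
    𝔼 ε : Fin n → ℤˣ, ‖∑ j, ε j • x j‖ ^ 2 ≤
      2 ^ 4 * (𝔼 ε : Fin n → ℤˣ, ‖∑ j, ε j • x j‖) ^ 2 := by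
  have h₃ := expect_sq_pow_three_le fun ε : Fin n → ℤˣ => norm_nonneg (∑ j, ε j • x j)
  have h₄ := expect_norm_signs_pow_le 1 x
  simp only [mul_one] at h₄
  set A := 𝔼 ε : Fin n → ℤˣ, ‖∑ j, ε j • x j‖
  set B := 𝔼 ε : Fin n → ℤˣ, ‖∑ j, ε j • x j‖ ^ 2
  obtain hB | hB := (Finset.expect_nonneg fun ε _ => sq_nonneg _ : 0 ≤ B).eq_or_lt
  · exact hB.symm.trans_le (by positivity)
  refine le_of_mul_le_mul_left ?_ (pow_pos hB 2)
  calc B ^ 2 * B = B ^ 3 := by ring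
    _ ≤ A ^ 2 * (2 ^ 4 * B ^ 2) := h₃.trans (mul_le_mul_of_nonneg_left h₄ (sq_nonneg A))
    _ = B ^ 2 * (2 ^ 4 * A ^ 2) := by ring

theorem exists_expect_norm_signs_two_pow_le (m : ℕ) : ∃ C : ℝ, 0 < C ∧
    ∀ (F : Type u) [SeminormedAddCommGroup F] [NormedSpace ℝ F] (n : ℕ) (x : Fin n → F),
      𝔼 ε : Fin n → ℤˣ, ‖∑ j, ε j • x j‖ ^ 2 ^ (m + 1) ≤
        C * (𝔼 ε : Fin n → ℤˣ, ‖∑ j, ε j • x j‖) ^ 2 ^ (m + 1) := by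
  induction m with
  | zero => exact ⟨2 ^ 4, by positivity, fun F _ _ n x => expect_norm_signs_sq_le x⟩
  | succ m ih =>
    obtain ⟨C, hC, h⟩ := ih
    refine ⟨2 ^ (4 * 2 ^ m) * C ^ 2, by positivity, fun F _ _ n x => ?_⟩
    calc 𝔼 ε : Fin n → ℤˣ, ‖∑ j, ε j • x j‖ ^ 2 ^ (m + 1 + 1)
        ≤ 2 ^ (4 * 2 ^ m) * (𝔼 ε : Fin n → ℤˣ, ‖∑ j, ε j • x j‖ ^ 2 ^ (m + 1)) ^ 2 := by
          convert expect_norm_signs_pow_le (2 ^ m) x using 6 <;> ring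
      _ ≤ 2 ^ (4 * 2 ^ m) * (C * (𝔼 ε : Fin n → ℤˣ, ‖∑ j, ε j • x j‖) ^ 2 ^ (m + 1)) ^ 2 := by
          gcongr
          exact h F n x
      _ = _ := by ring

end Kahane

section Rademacher

theorem ofReal_expect {ι : Type*} [Fintype ι] [Nonempty ι] {f : ι → ℝ} (hf : ∀ i, 0 ≤ f i) :
    ENNReal.ofReal (𝔼 i, f i) = (Fintype.card ι : ℝ≥0∞)⁻¹ * ∑ i, ENNReal.ofReal (f i) := by
  rw [Fintype.expect_eq_sum_div_card, ENNReal.ofReal_div_of_pos (by positivity),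
    ENNReal.ofReal_natCast, ENNReal.ofReal_sum_of_nonneg fun i _ => hf i, div_eq_mul_inv, mul_comm]

namespace IsRademacherFamily

variable {Ω : Type w} [MeasurableSpace Ω] {P : Measure Ω} {r : ℕ → Ω → ℝ} {n : ℕ}

theorem measure_forall_eq (hr : IsRademacherFamily r P) (ε : Fin n → ℤˣ) :
    P {ω | ∀ j : Fin n, r j ω = (ε j : ℤ)} = 2⁻¹ ^ n := by
  have hindep : iIndepFun (fun j : Fin n => r j) P := hr.indep.precomp Fin.val_injective
  have hj (j : Fin n) : P (r j ⁻¹' {((ε j : ℤ) : ℝ)}) = 2⁻¹ := by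
    rw [← one_div]
    obtain h | h := Int.units_eq_one_or (ε j) <;>
      simp only [h, Units.val_one, Units.val_neg, Int.cast_one, Int.cast_neg]
    · exact hr.prob_one j
    · exact hr.prob_neg_one j
  have hset : {ω | ∀ j : Fin n, r j ω = (ε j : ℤ)} =
      ⋂ j ∈ (Finset.univ : Finset (Fin n)), r j ⁻¹' {((ε j : ℤ) : ℝ)} := by
    ext ω
    simp
  rw [hset, hindep.measure_inter_preimage_eq_mul Finset.univ
    fun j _ => measurableSet_singleton _]
  simp [hj]

theorem exists_sign_eq (hr : IsRademacherFamily r P) (ω : Ω) (n : ℕ) :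
    ∃ ε : Fin n → ℤˣ, ∀ j : Fin n, r j ω = (ε j : ℤ) := by
  have h (j : Fin n) : ∃ s : ℤˣ, r j ω = (s : ℤ) := by
    obtain h | h := hr.range j ω
    · exact ⟨-1, by simp [h]⟩
    · exact ⟨1, by simp [h]⟩
  choose ε hε using h
  exact ⟨ε, hε⟩

theorem lintegral_eq (hr : IsRademacherFamily r P) {η : (Fin n → ℝ) → ℝ} (hη : ∀ e, 0 ≤ η e) :
    ∫⁻ ω, ENNReal.ofReal (η fun j => r j ω) ∂P =
      ENNReal.ofReal (𝔼 ε : Fin n → ℤˣ, η fun j => (ε j : ℤ)) := by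
  set S : (Fin n → ℤˣ) → Set Ω := fun ε => {ω | ∀ j : Fin n, r j ω = (ε j : ℤ)}
  have hS (ε : Fin n → ℤˣ) : MeasurableSet (S ε) := by
    simp only [S, Set.ofPred_forall]
    exact MeasurableSet.iInter fun j => hr.measurable j (measurableSet_singleton _)
  have hpt (ω : Ω) : ENNReal.ofReal (η fun j => r j ω) = ∑ ε : Fin n → ℤˣ,
      (S ε).indicator (fun _ => ENNReal.ofReal (η fun j => (ε j : ℤ))) ω := by
    obtain ⟨δ, hδ⟩ := hr.exists_sign_eq ω n
    rw [Fintype.sum_eq_single δ, Set.indicator_of_mem (show ω ∈ S δ from hδ)]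
    · simp only [hδ]
    · refine fun ε hε => Set.indicator_of_notMem (fun hω => hε (funext fun j => ?_)) _
      exact Units.ext (Int.cast_injective ((hω j).symm.trans (hδ j)))
  simp only [hpt]
  rw [lintegral_finsetSum _ fun ε _ => measurable_const.indicator (hS ε),
    ofReal_expect fun _ => hη _, Finset.mul_sum]
  refine Finset.sum_congr rfl fun ε _ => ?_
  rw [lintegral_indicator_const (hS ε), hr.measure_forall_eq, mul_comm]
  simp [Fintype.card_pi, ENNReal.inv_pow]

theorem eLpNorm_eq (hr : IsRademacherFamily r P) {F : Type*} [NormedAddCommGroup F]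
    [NormedSpace ℝ F] {s : ℝ} (hs : 0 < s) (x : Fin n → F) :
    eLpNorm (fun ω => ∑ j : Fin n, r j ω • x j) (ENNReal.ofReal s) P =
      ENNReal.ofReal ((𝔼 ε : Fin n → ℤˣ, ‖∑ j, ε j • x j‖ ^ s) ^ (1 / s)) := by
  have h := hr.lintegral_eq (η := fun e : Fin n → ℝ => ‖∑ j, e j • x j‖ ^ s)
    fun e => by positivity
  simp only [Int.cast_smul_eq_zsmul, ← Units.smul_def] at h
  rw [eLpNorm_eq_lintegral_rpow_enorm_toReal (by simpa using hs) ENNReal.ofReal_ne_top,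
    ENNReal.toReal_ofReal hs.le, ← ENNReal.ofReal_rpow_of_nonneg
      (Finset.expect_nonneg fun ε _ => by positivity) (by positivity), ← h]
  simp only [← ofReal_norm, ENNReal.ofReal_rpow_of_nonneg (norm_nonneg _) hs.le]

theorem aestronglyMeasurable_sum_smul (hr : IsRademacherFamily r P) {F : Type*}
    [NormedAddCommGroup F] [NormedSpace ℝ F] (x : Fin n → F) :
    AEStronglyMeasurable (fun ω => ∑ j : Fin n, r j ω • x j) P :=
  Finset.aestronglyMeasurable_fun_sum _ fun j _ =>
    ((hr.measurable j).stronglyMeasurable.smul_const (x j)).aestronglyMeasurable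

end IsRademacherFamily

theorem exists_fair_sign : ∃ (μ : Measure (ULift.{w} Bool)) (s : ULift.{w} Bool → ℝ),
    IsProbabilityMeasure μ ∧ Measurable s ∧ (∀ b, s b = -1 ∨ s b = 1) ∧
      μ {b | s b = -1} = 1 / 2 ∧ μ {b | s b = 1} = 1 / 2 := by
  let s : ULift.{w} Bool → ℝ := fun b => if b.down then 1 else -1
  have hneg : {b | s b = -1} = {⟨false⟩} := by
    ext ⟨b⟩
    cases b <;> norm_num [s]
  have hone : {b | s b = 1} = {⟨true⟩} := by
    ext ⟨b⟩
    cases b <;> norm_num [s]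
  refine ⟨(PMF.uniformOfFintype _).toMeasure, s, inferInstance, measurable_of_countable _,
    fun b => ?_, ?_, ?_⟩
  · exact (ite_eq_or_eq _ _ _).symm
  · rw [hneg, PMF.toMeasure_apply_singleton _ _ (measurableSet_singleton _)]
    simp
  · rw [hone, PMF.toMeasure_apply_singleton _ _ (measurableSet_singleton _)]
    simp

theorem exists_isRademacherFamily : ∃ (Ω : Type w) (_ : MeasurableSpace Ω) (P : Measure Ω)
    (r : ℕ → Ω → ℝ), IsProbabilityMeasure P ∧ P.IsComplete ∧ IsRademacherFamily r P := by
  obtain ⟨μ, s, _, hs, hrange, hneg, hone⟩ := exists_fair_sign.{w}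
  let ν : Measure (ℕ → ULift.{w} Bool) := Measure.infinitePi fun _ => μ
  have hprob (t : ℝ) (j : ℕ) : ν {ω | s (ω j) = t} = μ {b | s b = t} :=
    (measurePreserving_eval_infinitePi (fun _ => μ) j).measure_preimage
      (hs (measurableSet_singleton t)).nullMeasurableSet
  have hindep : iIndepFun (fun j ω => s (ω j)) ν := iIndepFun_infinitePi fun _ => hs
  refine ⟨NullMeasurableSpace (ℕ → ULift.{w} Bool) ν, inferInstance, ν.completion,
    fun j ω => s (ω j), ⟨measure_univ (μ := ν)⟩, inferInstance, ?_⟩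
  exact {
    measurable := fun j _ ht => (hs.comp (measurable_pi_apply j) ht).nullMeasurableSet
    range := fun j ω => hrange (ω j)
    prob_neg_one := fun j => (hprob (-1) j).trans hneg
    prob_one := fun j => (hprob 1 j).trans hone
    indep := iIndepFun_iff_measure_inter_preimage_eq_mul.2
      (iIndepFun_iff_measure_inter_preimage_eq_mul.1 hindep) }

theorem kahaneKhintchineConst_nonneg (q p : ℝ) : 0 ≤ kahaneKhintchineConst.{u, w} q p :=
  Real.sInf_nonneg fun _ h => h.1.le

theorem typeConst_nonneg (F : Type u) [NormedAddCommGroup F] [NormedSpace ℝ F] (p : ℝ) :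
    0 ≤ typeConst.{u, w} F p :=
  Real.sInf_nonneg fun _ h => h.1.le

theorem khintchineConst_nonneg (q : ℝ) : 0 ≤ khintchineConst.{w} q :=
  Real.sInf_nonneg fun _ h => h.1.le

theorem exists_expect_norm_signs_natCast_rpow_le (m : ℕ) : ∃ C : ℝ, 0 < C ∧
    ∀ (F : Type u) [SeminormedAddCommGroup F] [NormedSpace ℝ F] (n : ℕ) (x : Fin n → F),
      (𝔼 ε : Fin n → ℤˣ, ‖∑ j, ε j • x j‖ ^ ((2 ^ (m + 1) : ℕ) : ℝ)) ^
        (1 / ((2 ^ (m + 1) : ℕ) : ℝ)) ≤ C * 𝔼 ε : Fin n → ℤˣ, ‖∑ j, ε j • x j‖ := by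
  obtain ⟨C, hC, h⟩ := exists_expect_norm_signs_two_pow_le.{u} m
  refine ⟨C ^ (1 / ((2 ^ (m + 1) : ℕ) : ℝ)), by positivity, fun F _ _ n x => ?_⟩
  have h₀ : 0 ≤ 𝔼 ε : Fin n → ℤˣ, ‖∑ j, ε j • x j‖ :=
    Finset.expect_nonneg fun ε _ => norm_nonneg _
  simp only [Real.rpow_natCast]
  refine (Real.rpow_le_rpow (Finset.expect_nonneg fun ε _ => by positivity) (h F n x)
    (by positivity)).trans_eq ?_
  rw [Real.mul_rpow hC.le (by positivity), one_div,
    Real.pow_rpow_inv_natCast h₀ (by positivity)]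

theorem exists_isKahaneKhintchineBound {p : ℝ} (hp : 1 ≤ p) (q : ℝ) :
    ∃ K, IsKahaneKhintchineBound.{u, w} q p K := by
  obtain ⟨m, hm⟩ := pow_unbounded_of_one_lt q one_lt_two
  obtain ⟨K, hK, h⟩ := exists_expect_norm_signs_natCast_rpow_le.{u} m
  refine ⟨K, hK, fun Ω _ P _ _ r hr F _ _ _ n x => ?_⟩
  set N : ℕ := 2 ^ (m + 1)
  have hqN : q ≤ N := by
    refine hm.le.trans ?_
    exact_mod_cast pow_le_pow_right₀ one_le_two m.le_succ
  have hmeas := hr.aestronglyMeasurable_sum_smul x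
  calc eLpNorm (fun ω => ∑ j : Fin n, r j ω • x j) (ENNReal.ofReal q) P
      ≤ eLpNorm (fun ω => ∑ j : Fin n, r j ω • x j) (ENNReal.ofReal N) P :=
        eLpNorm_le_eLpNorm_of_exponent_le (ENNReal.ofReal_le_ofReal hqN) hmeas
    _ ≤ ENNReal.ofReal K *
        eLpNorm (fun ω => ∑ j : Fin n, r j ω • x j) (ENNReal.ofReal 1) P := by
        rw [hr.eLpNorm_eq (by positivity), hr.eLpNorm_eq one_pos, ← ENNReal.ofReal_mul hK.le]
        simp only [Real.rpow_one, div_one]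
        exact ENNReal.ofReal_le_ofReal (h F n x)
    _ ≤ _ := by
        gcongr
        exact eLpNorm_le_eLpNorm_of_exponent_le (ENNReal.ofReal_le_ofReal hp) hmeas

theorem le_sInf_mul {S : Set ℝ} (hS : S.Nonempty) {A B : ℝ} (hB : 0 ≤ B)
    (h : ∀ K ∈ S, A ≤ K * B) : A ≤ sInf S * B := by
  obtain rfl | hB := hB.eq_or_lt
  · obtain ⟨K, hK⟩ := hS
    simpa using h K hK
  · rw [← div_le_iff₀ hB]
    exact le_csInf hS fun K hK => (div_le_iff₀ hB).2 (h K hK)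

theorem expect_norm_signs_rpow_nonneg {F : Type*} [SeminormedAddCommGroup F] {n : ℕ}
    (x : Fin n → F) (s : ℝ) : 0 ≤ 𝔼 ε : Fin n → ℤˣ, ‖∑ j, ε j • x j‖ ^ s :=
  Finset.expect_nonneg fun _ _ => by positivity

theorem expect_norm_signs_le_kahaneKhintchineConst {p q : ℝ} (hp : 1 ≤ p) (hq : 0 < q)
    {F : Type u} [SeminormedAddCommGroup F] [NormedSpace ℝ F] {n : ℕ} (x : Fin n → F) :
    (𝔼 ε : Fin n → ℤˣ, ‖∑ j, ε j • x j‖ ^ q) ^ (1 / q) ≤ kahaneKhintchineConst.{u, w} q p *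
      (𝔼 ε : Fin n → ℤˣ, ‖∑ j, ε j • x j‖ ^ p) ^ (1 / p) := by
  obtain ⟨Ω, _, P, r, _, _, hr⟩ := exists_isRademacherFamily.{w}
  have hnonneg := Real.rpow_nonneg (expect_norm_signs_rpow_nonneg x p) (1 / p)
  have hnorm (ε : Fin n → ℤˣ) :
      ‖∑ j, ε j • (x j : UniformSpace.Completion F)‖ = ‖∑ j, ε j • x j‖ := by
    have h := (UniformSpace.Completion.toComplₗᵢ (𝕜 := ℝ)).norm_map (∑ j, ε j • x j)
    simpa only [map_sum, Units.smul_def, map_zsmul,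
      UniformSpace.Completion.coe_toComplₗᵢ] using h
  refine le_sInf_mul (exists_isKahaneKhintchineBound.{u, w} hp q) hnonneg fun K hK => ?_
  have h := hK.2 Ω P r hr (UniformSpace.Completion F) n fun j => x j
  rw [hr.eLpNorm_eq hq, hr.eLpNorm_eq (by linarith), ← ENNReal.ofReal_mul hK.1.le] at h
  simp only [hnorm] at h
  exact (ENNReal.ofReal_le_ofReal_iff (mul_nonneg hK.1.le hnonneg)).1 h

variable {F : Type u} [NormedAddCommGroup F] [NormedSpace ℝ F] {p q : ℝ} {n : ℕ}

theorem expect_norm_signs_le_typeConst (hp : 0 < p) (hF : HasRademacherType.{u, w} F p)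
    (x : Fin n → F) :
    (𝔼 ε : Fin n → ℤˣ, ‖∑ j, ε j • x j‖ ^ p) ^ (1 / p) ≤
      typeConst.{u, w} F p * (∑ j, ‖x j‖ ^ p) ^ (1 / p) := by
  obtain ⟨Ω, _, P, r, _, _, hr⟩ := exists_isRademacherFamily.{w}
  have hnonneg : 0 ≤ (∑ j, ‖x j‖ ^ p) ^ (1 / p) := by positivity
  refine le_sInf_mul hF hnonneg fun τ hτ => ?_
  have h := hτ.2 Ω P r hr n x
  rwa [hr.eLpNorm_eq hp, ENNReal.ofReal_le_ofReal_iff (mul_nonneg hτ.1.le hnonneg)] at h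

theorem expect_norm_signs_rpow_le_of_hasRademacherType (hp : 1 ≤ p) (hq : 0 < q)
    (hF : HasRademacherType.{u, w} F p) (x : Fin n → F) :
    (𝔼 ε : Fin n → ℤˣ, ‖∑ j, ε j • x j‖ ^ q) ^ (1 / q) ≤
      kahaneKhintchineConst.{u, w} q p * typeConst.{u, w} F p *
        (∑ j, ‖x j‖ ^ p) ^ (1 / p) := by
  rw [mul_assoc]
  exact (expect_norm_signs_le_kahaneKhintchineConst hp hq x).trans
    (mul_le_mul_of_nonneg_left (expect_norm_signs_le_typeConst (by linarith) hF x)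
      (kahaneKhintchineConst_nonneg q p))

end Rademacher

section Symmetrization

theorem eLpNorm_integral_le_eLpNorm_prod {X Z F : Type*} [MeasurableSpace X] [MeasurableSpace Z]
    [NormedAddCommGroup F] [NormedSpace ℝ F] {μ : Measure X} {ν : Measure Z} [SFinite μ]
    [IsProbabilityMeasure ν] {f : X × Z → F} (hf : AEStronglyMeasurable f (μ.prod ν))
    {q : ℝ} (hq : 1 ≤ q) :
    eLpNorm (fun x => ∫ z, f (x, z) ∂ν) (ENNReal.ofReal q) μ ≤
      eLpNorm f (ENNReal.ofReal q) (μ.prod ν) := by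
  have hq₀ : 0 < q := by linarith
  simp only [eLpNorm_eq_lintegral_rpow_enorm_toReal (ENNReal.ofReal_pos.2 hq₀).ne'
    ENNReal.ofReal_ne_top, ENNReal.toReal_ofReal hq₀.le]
  rw [lintegral_prod _ (hf.enorm.pow_const q)]
  refine ENNReal.rpow_le_rpow (lintegral_mono_ae ?_) (by positivity)
  filter_upwards [hf.prodMk_left] with x hx
  have jensen := eLpNorm'_le_eLpNorm'_of_exponent_le one_pos hq ν hx
  simp only [eLpNorm', ENNReal.rpow_one, div_one, one_div] at jensen
  exact (ENNReal.rpow_le_rpow (enorm_integral_le_lintegral_enorm _) hq₀.le).trans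
    ((ENNReal.le_rpow_inv_iff hq₀).1 jensen)

theorem le_eLpNorm_expect_rpow {X F ι : Type*} [MeasurableSpace X] [NormedAddCommGroup F]
    [Fintype ι] [Nonempty ι] {μ : Measure X} {f : ι → X → F}
    (hf : ∀ i, AEStronglyMeasurable (f i) μ) {q : ℝ} (hq : 0 < q) {c : ℝ≥0∞}
    (hc : ∀ i, c ≤ eLpNorm (f i) (ENNReal.ofReal q) μ) :
    c ≤ eLpNorm (fun x => (𝔼 i, ‖f i x‖ ^ q) ^ (1 / q)) (ENNReal.ofReal q) μ := by
  simp only [eLpNorm_eq_lintegral_rpow_enorm_toReal (ENNReal.ofReal_pos.2 hq).ne'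
    ENNReal.ofReal_ne_top, ENNReal.toReal_ofReal hq.le, one_div, ENNReal.le_rpow_inv_iff hq]
    at hc ⊢
  have hpt (x : X) : ‖(𝔼 i, ‖f i x‖ ^ q) ^ q⁻¹‖ₑ ^ q =
      (Fintype.card ι : ℝ≥0∞)⁻¹ * ∑ i, ‖f i x‖ₑ ^ q := by
    have h₀ : 0 ≤ 𝔼 i, ‖f i x‖ ^ q := Finset.expect_nonneg fun i _ => by positivity
    rw [Real.enorm_of_nonneg (by positivity), ENNReal.ofReal_rpow_of_nonneg (by positivity) hq.le,
      Real.rpow_inv_rpow h₀ hq.ne', ofReal_expect fun i => by positivity]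
    simp only [← ENNReal.ofReal_rpow_of_nonneg (norm_nonneg _) hq.le, ofReal_norm]
  simp only [hpt]
  rw [lintegral_const_mul' _ _ (by simp), lintegral_finsetSum' _ fun i _ =>
    (hf i).enorm.pow_const q, mul_comm, ← div_eq_mul_inv,
    ENNReal.le_div_iff_mul_le (by simp) (by simp), mul_comm]
  simpa using Finset.card_nsmul_le_sum Finset.univ _ _ fun i _ => hc i

variable {ι X F : Type*} [Fintype ι] [MeasurableSpace X] [NormedAddCommGroup F]

theorem measurePreserving_swap_signs (μ : ι → Measure X) [∀ j, IsProbabilityMeasure (μ j)]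
    (ε : ι → ℤˣ) :
    MeasurePreserving (fun (z : ι → X × X) j => if ε j = 1 then z j else (z j).swap)
      (Measure.pi fun j => (μ j).prod (μ j)) (Measure.pi fun j => (μ j).prod (μ j)) := by
  refine measurePreserving_pi _ (fun j => (μ j).prod (μ j))
    (f := fun j z => if ε j = 1 then z else z.swap) fun j => ?_
  split_ifs
  · exact MeasurePreserving.id _
  · exact Measure.measurePreserving_swap

theorem aestronglyMeasurable_sum_pi {μ : ι → Measure X} [∀ j, IsProbabilityMeasure (μ j)]
    {Y : ι → X → F} (hY : ∀ j, AEStronglyMeasurable (Y j) (μ j)) :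
    AEStronglyMeasurable (fun x : ι → X => ∑ j, Y j (x j)) (Measure.pi μ) :=
  Finset.aestronglyMeasurable_fun_sum _ fun j _ =>
    (hY j).comp_quasiMeasurePreserving (measurePreserving_eval μ j).quasiMeasurePreserving

theorem eLpNorm_sum_sub_le_two_mul_signs {μ : ι → Measure X} [∀ j, IsProbabilityMeasure (μ j)]
    {Y : ι → X → F} (hY : ∀ j, AEStronglyMeasurable (Y j) (μ j)) {q : ℝ≥0∞} (hq : 1 ≤ q)
    (ε : ι → ℤˣ) :
    eLpNorm (fun z : ι → X × X => ∑ j, (Y j (z j).2 - Y j (z j).1)) q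
        (Measure.pi fun j => (μ j).prod (μ j)) ≤
      2 * eLpNorm (fun x : ι → X => ∑ j, ε j • Y j (x j)) q (Measure.pi μ) := by
  set ρ : Measure (ι → X × X) := Measure.pi fun j => (μ j).prod (μ j)
  have hfst : MeasurePreserving (fun (z : ι → X × X) j => (z j).1) ρ (Measure.pi μ) :=
    measurePreserving_pi _ _ fun _ => measurePreserving_fst
  have hsnd : MeasurePreserving (fun (z : ι → X × X) j => (z j).2) ρ (Measure.pi μ) :=
    measurePreserving_pi _ _ fun _ => measurePreserving_snd
  have hS : AEStronglyMeasurable (fun x : ι → X => ∑ j, ε j • Y j (x j)) (Measure.pi μ) :=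
    aestronglyMeasurable_sum_pi fun j => (hY j).const_smul _
  have hD : AEStronglyMeasurable (fun z : ι → X × X => ∑ j, (Y j (z j).2 - Y j (z j).1)) ρ :=
    aestronglyMeasurable_sum_pi fun j => (hY j).comp_snd.sub (hY j).comp_fst
  have hswap (z : ι → X × X) :
      ∑ j, (Y j (if ε j = 1 then z j else (z j).swap).2 -
        Y j (if ε j = 1 then z j else (z j).swap).1) =
      ∑ j, ε j • Y j (z j).2 - ∑ j, ε j • Y j (z j).1 := by
    rw [← Finset.sum_sub_distrib]
    refine Finset.sum_congr rfl fun j _ => ?_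
    obtain h | h := Int.units_eq_one_or (ε j)
    · simp [h]
    · simp [h, Units.smul_def, add_comm, sub_eq_add_neg]
  calc eLpNorm (fun z : ι → X × X => ∑ j, (Y j (z j).2 - Y j (z j).1)) q ρ
      = eLpNorm (fun z : ι → X × X => ∑ j, ε j • Y j (z j).2 - ∑ j, ε j • Y j (z j).1) q ρ := by
        rw [← eLpNorm_comp_measurePreserving hD (measurePreserving_swap_signs μ ε)]
        exact congrArg (eLpNorm · q ρ) (funext hswap)
    _ ≤ eLpNorm (fun z : ι → X × X => ∑ j, ε j • Y j (z j).2) q ρ +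
          eLpNorm (fun z : ι → X × X => ∑ j, ε j • Y j (z j).1) q ρ :=
        eLpNorm_sub_le (hS.comp_measurePreserving hsnd) (hS.comp_measurePreserving hfst) hq
    _ = 2 * eLpNorm (fun x : ι → X => ∑ j, ε j • Y j (x j)) q (Measure.pi μ) := by
        rw [two_mul]
        exact congrArg₂ (· + ·) (eLpNorm_comp_measurePreserving hS hsnd)
          (eLpNorm_comp_measurePreserving hS hfst)

variable [NormedSpace ℝ F] [CompleteSpace F]

theorem eLpNorm_sum_integral_sub_le_sum_sub {μ : ι → Measure X}
    [∀ j, IsProbabilityMeasure (μ j)] {Y : ι → X → F} (hY : ∀ j, Integrable (Y j) (μ j))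
    {q : ℝ} (hq : 1 ≤ q) :
    eLpNorm (fun x : ι → X => ∑ j, (∫ y, Y j y ∂μ j - Y j (x j))) (ENNReal.ofReal q)
        (Measure.pi μ) ≤
      eLpNorm (fun z : ι → X × X => ∑ j, (Y j (z j).2 - Y j (z j).1)) (ENNReal.ofReal q)
        (Measure.pi fun j => (μ j).prod (μ j)) := by
  set ν : Measure (ι → X) := Measure.pi μ
  have hint (j : ι) : Integrable (fun x : ι → X => Y j (x j)) ν :=
    (measurePreserving_eval μ j).integrable_comp_of_integrable (hY j)
  have hmean (j : ι) : ∫ x, Y j (x j) ∂ν = ∫ y, Y j y ∂μ j := by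
    rw [← (measurePreserving_eval μ j).map_eq, integral_map (measurable_pi_apply j).aemeasurable]
    rw [(measurePreserving_eval μ j).map_eq]
    exact (hY j).aestronglyMeasurable
  have hcopy (x : ι → X) : ∑ j, (∫ y, Y j y ∂μ j - Y j (x j)) =
      ∫ x', ∑ j, (Y j (x' j) - Y j (x j)) ∂ν := by
    rw [integral_finsetSum Finset.univ (f := fun j (x' : ι → X) => Y j (x' j) - Y j (x j))
      fun j _ => (hint j).sub (integrable_const _)]
    refine Finset.sum_congr rfl fun j _ => ?_
    rw [integral_sub (hint j) (integrable_const _), hmean j, integral_const, probReal_univ,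
      one_smul]
  have hmeas : AEStronglyMeasurable (fun z : (ι → X) × (ι → X) =>
      ∑ j, (Y j (z.2 j) - Y j (z.1 j))) (ν.prod ν) :=
    Finset.aestronglyMeasurable_fun_sum _ fun j _ =>
      (hint j).aestronglyMeasurable.comp_snd.sub (hint j).aestronglyMeasurable.comp_fst
  simp only [hcopy]
  refine (eLpNorm_integral_le_eLpNorm_prod hmeas hq).trans_eq ?_
  exact (eLpNorm_comp_measurePreserving hmeas
    (measurePreserving_arrowProdEquivProdArrow X X ι μ μ)).symm

theorem eLpNorm_sum_integral_sub_le_expect_signs [DecidableEq ι] {Ω : Type*}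
    [MeasurableSpace Ω] {P : Measure Ω} [IsProbabilityMeasure P] {ξ : ι → Ω → X}
    (hξ : ∀ j, AEMeasurable (ξ j) P) (hindep : iIndepFun ξ P) {Y : ι → X → F}
    (hY : ∀ j, Integrable (Y j) (P.map (ξ j))) {q : ℝ} (hq : 1 ≤ q) :
    eLpNorm (fun ω => ∑ j, (∫ ω', Y j (ξ j ω') ∂P - Y j (ξ j ω))) (ENNReal.ofReal q) P ≤
      2 * eLpNorm (fun ω => (𝔼 ε : ι → ℤˣ, ‖∑ j, ε j • Y j (ξ j ω)‖ ^ q) ^ (1 / q))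
        (ENNReal.ofReal q) P := by
  have (j : ι) : IsProbabilityMeasure (P.map (ξ j)) := Measure.isProbabilityMeasure_map (hξ j)
  have hYm (j : ι) := (hY j).aestronglyMeasurable
  have hlaw (Z : ι → X → F) (hZ : ∀ j, AEStronglyMeasurable (Z j) (P.map (ξ j))) :
      AEStronglyMeasurable (fun ω => ∑ j, Z j (ξ j ω)) P ∧
      eLpNorm (fun x : ι → X => ∑ j, Z j (x j)) (ENNReal.ofReal q)
        (Measure.pi fun j => P.map (ξ j)) =
      eLpNorm (fun ω => ∑ j, Z j (ξ j ω)) (ENNReal.ofReal q) P := by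
    have hg := aestronglyMeasurable_sum_pi hZ
    rw [← (iIndepFun_iff_map_fun_eq_pi_map hξ).1 hindep] at hg ⊢
    exact ⟨hg.comp_aemeasurable (aemeasurable_pi_lambda _ hξ),
      eLpNorm_map_measure hg (aemeasurable_pi_lambda _ hξ)⟩
  have hsigns (ε : ι → ℤˣ) := hlaw (fun j x => ε j • Y j x) fun j => (hYm j).const_smul (ε j)
  rw [← ENNReal.div_le_iff' two_ne_zero ENNReal.ofNat_ne_top]
  refine le_eLpNorm_expect_rpow (fun ε => (hsigns ε).1) (by linarith) fun ε => ?_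
  rw [ENNReal.div_le_iff' two_ne_zero ENNReal.ofNat_ne_top]
  calc eLpNorm (fun ω => ∑ j, (∫ ω', Y j (ξ j ω') ∂P - Y j (ξ j ω))) (ENNReal.ofReal q) P
      = eLpNorm (fun x : ι → X => ∑ j, (∫ y, Y j y ∂P.map (ξ j) - Y j (x j)))
          (ENNReal.ofReal q) (Measure.pi fun j => P.map (ξ j)) := by
        rw [(hlaw (fun j x => ∫ y, Y j y ∂P.map (ξ j) - Y j x)
          fun j => aestronglyMeasurable_const.sub (hYm j)).2]
        simp only [integral_map (hξ _) (hYm _)]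
    _ ≤ _ := eLpNorm_sum_integral_sub_le_sum_sub hY hq
    _ ≤ _ := eLpNorm_sum_sub_le_two_mul_signs hYm (by simpa using hq) ε
    _ = _ := congrArg _ (hsigns ε).2

end Symmetrization

section TensorPower

open scoped BoundedContinuousFunction

variable {k : ℕ} {E : Type u} [NormedAddCommGroup E] [NormedSpace ℝ E]

/-- The canonical multilinear map into the algebraic tensor product carrying the injective norm. -/
noncomputable def algTprod (k : ℕ) (E : Type u) [NormedAddCommGroup E] [NormedSpace ℝ E] :
    MultilinearMap ℝ (fun _ : Fin k => E) (AlgTensor k E) :=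
  (PiTensorProduct.tprod ℝ : MultilinearMap ℝ (fun _ : Fin k => E) (⨂[ℝ] _ : Fin k, E))

theorem norm_algTprod_le (x : Fin k → E) : ‖algTprod k E x‖ ≤ ∏ i, ‖x i‖ := by
  refine AlgTensor.norm_le _ _ fun f hf => (congrArg _ (dualTensor_tprod f x)).trans_le ?_
  rw [Finset.abs_prod]
  gcongr with i
  exact ((f i).le_of_opNorm_le (hf i) (x i)).trans_eq (one_mul _)

theorem norm_tensorPow_le (x : E) : ‖tensorPow k x‖ ≤ ‖x‖ ^ k := by
  rw [tensorPow, UniformSpace.Completion.norm_coe]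
  exact (norm_algTprod_le fun _ : Fin k => x).trans_eq (Fin.prod_const k ‖x‖)

theorem continuous_tensorPow : Continuous (tensorPow k : E → InjTensor k E) := by
  have h : Continuous (algTprod k E) :=
    (algTprod k E).continuous_of_bound 1 fun x => by simpa only [one_mul] using norm_algTprod_le x
  exact (UniformSpace.Completion.continuous_coe _).comp
    (h.comp (continuous_pi fun _ => continuous_id))

theorem symmetrize_tprod_const (x : E) :
    symmetrize k E (PiTensorProduct.tprod ℝ fun _ => x) = PiTensorProduct.tprod ℝ fun _ => x := by
  rw [symmetrize_tprod, Finset.sum_const, Finset.card_univ, Fintype.card_perm, Fintype.card_fin,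
    ← Nat.cast_smul_eq_nsmul ℝ, smul_smul, inv_mul_cancel₀ (by positivity), one_smul]

theorem symProj_tensorPow (x : E) : symProj k E (tensorPow k x) = symTensorPow k x := by
  have h : symProjAlgₗ k E (AlgTensor.pow k x) = SymAlgTensor.pow k x :=
    Subtype.ext (symmetrize_tprod_const x)
  rw [symProj, tensorPow, symTensorPow, ← h]
  exact ContinuousLinearMap.completion_apply_coe _ _

theorem continuous_symTensorPow : Continuous (symTensorPow k : E → SymInjTensor k E) :=
  ((symProj k E).continuous.comp continuous_tensorPow).congr symProj_tensorPow

theorem norm_symTensorPow_le (x : E) : ‖symTensorPow k x‖ ≤ ‖x‖ ^ k := by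
  rw [symTensorPow, UniformSpace.Completion.norm_coe]
  refine SymAlgTensor.norm_le _ _ fun f hf => ?_
  refine (congrArg _ (dualTensor_tprod (fun _ => f) fun _ => x)).trans_le ?_
  rw [Fin.prod_const, abs_pow]
  gcongr
  exact (f.le_of_opNorm_le hf x).trans_eq (one_mul _)

theorem convex_symPart : Convex ℝ (symPart k E) := by
  let L : SymAlgTensor k E →ₗ[ℝ] InjTensor k E :=
    (UniformSpace.Completion.toComplₗᵢ (𝕜 := ℝ) (E := AlgTensor k E)).toLinearMap ∘ₗ symIncl k E
  exact (LinearMap.range L).convex.closure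

theorem tensorPow_mem_symPart (x : E) : tensorPow k x ∈ symPart k E :=
  subset_closure ⟨SymAlgTensor.pow k x, rfl⟩

/-- The vectors of `E` as functions on the unit ball of the dual space; the powers of these
functions carry the symmetric injective norm, see `norm_sum_smul_symTensorPow`. -/
noncomputable def dualBallEval (E : Type u) [NormedAddCommGroup E] [NormedSpace ℝ E] :
    E →ₗ[ℝ] ({f : StrongDual ℝ E // ‖f‖ ≤ 1} →ᵇ ℝ) where
  toFun x := BoundedContinuousFunction.ofNormedAddCommGroup (fun f => f.1 x)
    ((ContinuousLinearMap.apply ℝ ℝ x).continuous.comp continuous_subtype_val) ‖x‖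
    fun f => (f.1.le_of_opNorm_le f.2 x).trans_eq (one_mul _)
  map_add' x y := BoundedContinuousFunction.ext fun f => map_add f.1 x y
  map_smul' c x := BoundedContinuousFunction.ext fun f => map_smul f.1 c x

theorem norm_dualBallEval_le (x : E) : ‖dualBallEval E x‖ ≤ ‖x‖ :=
  BoundedContinuousFunction.norm_ofNormedAddCommGroup_le _ (norm_nonneg x) fun f =>
    (f.1.le_of_opNorm_le f.2 x).trans_eq (one_mul _)

theorem abs_dualBallEval_apply_le (x : E) (f : {f : StrongDual ℝ E // ‖f‖ ≤ 1}) :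
    |dualBallEval E x f| ≤ ‖x‖ :=
  ((dualBallEval E x).norm_coe_le_norm f).trans (norm_dualBallEval_le x)

theorem norm_sum_smul_symTensorPow {ι : Type*} [Fintype ι] (c : ι → ℝ) (x : ι → E) :
    ‖∑ j, c j • symTensorPow k (x j)‖ = ‖∑ j, c j • dualBallEval E (x j) ^ k‖ := by
  have hcoe : ∑ j, c j • symTensorPow k (x j) =
      ((∑ j, c j • SymAlgTensor.pow k (x j) : SymAlgTensor k E) : SymInjTensor k E) := by
    change _ = UniformSpace.Completion.toComplₗᵢ (𝕜 := ℝ) _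
    simp only [map_sum, map_smul]
    rfl
  have hpow (f : StrongDual ℝ E) (y : E) :
      dualTensor (fun _ => f) (symIncl k E (SymAlgTensor.pow k y)) = f y ^ k :=
    (dualTensor_tprod (fun _ => f) fun _ => y).trans (Fin.prod_const k _)
  rw [hcoe, UniformSpace.Completion.norm_coe, BoundedContinuousFunction.norm_eq_iSup_norm]
  refine iSup_congr fun f => congrArg _ ?_
  rw [map_sum, BoundedContinuousFunction.sum_apply]
  refine (map_sum (dualTensor fun _ => f.1) _ _).trans (Finset.sum_congr rfl fun j _ => ?_)
  rw [map_smul]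
  exact ((dualTensor fun _ => f.1).map_smul (c j) _).trans (congrArg (c j • ·) (hpow f.1 (x j)))

theorem abs_pow_sub_pow_le_of_abs_le {s t R : ℝ} (hs : |s| ≤ R) (ht : |t| ≤ R) (k : ℕ) :
    |s ^ k - t ^ k| ≤ k * R ^ (k - 1) * |s - t| := by
  calc |s ^ k - t ^ k| ≤ |s - t| * k * max |s| |t| ^ (k - 1) := abs_pow_sub_pow_le s t k
    _ ≤ |s - t| * k * R ^ (k - 1) := by
        gcongr
        exact max_le hs ht
    _ = k * R ^ (k - 1) * |s - t| := by ring

theorem expect_norm_signs_symTensorPow_le {q : ℝ} (hq : 1 ≤ q) (hk : k ≠ 0) {n : ℕ}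
    (x : Fin n → E) :
    (𝔼 ε : Fin n → ℤˣ, ‖∑ j, ε j • symTensorPow k (x j)‖ ^ q) ^ (1 / q) ≤
      2 * (𝔼 ε : Fin n → ℤˣ, ‖∑ j, ε j • (k * ‖x j‖ ^ (k - 1)) • x j‖ ^ q) ^ (1 / q) := by
  have : Nonempty {f : StrongDual ℝ E // ‖f‖ ≤ 1} := ⟨⟨0, by simp⟩⟩
  set y : Fin n → E := fun j => ((k : ℝ) * ‖x j‖ ^ (k - 1)) • x j
  have hlip (j : Fin n) (s t : ℝ) (hs : |s| ≤ ‖x j‖) (ht : |t| ≤ ‖x j‖) :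
      |s ^ k - t ^ k| ≤ |k * ‖x j‖ ^ (k - 1) * s - k * ‖x j‖ ^ (k - 1) * t| := by
    rw [← mul_sub, abs_mul, abs_of_nonneg (by positivity : 0 ≤ (k : ℝ) * ‖x j‖ ^ (k - 1))]
    exact abs_pow_sub_pow_le_of_abs_le hs ht k
  have hpow (ε : Fin n → ℤˣ) : ‖∑ j, ε j • symTensorPow k (x j)‖ =
      ‖∑ j, ε j • dualBallEval E (x j) ^ k‖ := by
    simp only [Units.smul_def, ← Int.cast_smul_eq_zsmul ℝ]
    exact norm_sum_smul_symTensorPow _ x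
  have hlin (ε : Fin n → ℤˣ) : ‖∑ j, ε j • dualBallEval E (y j)‖ ≤ ‖∑ j, ε j • y j‖ := by
    simpa only [map_sum, Units.smul_def, map_zsmul] using norm_dualBallEval_le (∑ j, ε j • y j)
  have hcontr := expect_norm_signs_le_of_contraction hq (fun j => dualBallEval E (x j) ^ k)
    (fun j => dualBallEval E (y j))
    (fun j f => by
      simpa [y, hk] using hlip j _ 0 (abs_dualBallEval_apply_le _ f) (by simp))
    (fun j f g => by
      simpa [y] using
        hlip j _ _ (abs_dualBallEval_apply_le _ f) (abs_dualBallEval_apply_le _ g))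
  have hle : 𝔼 ε : Fin n → ℤˣ, ‖∑ j, ε j • symTensorPow k (x j)‖ ^ q ≤
      2 ^ q * 𝔼 ε : Fin n → ℤˣ, ‖∑ j, ε j • y j‖ ^ q := by
    simp only [hpow]
    exact hcontr.trans (mul_le_mul (Real.self_le_rpow_of_one_le one_le_two hq)
      (Finset.expect_le_expect fun ε _ => by gcongr; exact hlin ε)
      (expect_norm_signs_rpow_nonneg _ q) (by positivity))
  refine (Real.rpow_le_rpow (expect_norm_signs_rpow_nonneg _ q) hle (by positivity)).trans_eq ?_
  rw [Real.mul_rpow (by positivity) (expect_norm_signs_rpow_nonneg y q), one_div,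
    Real.rpow_rpow_inv zero_le_two (by positivity)]

theorem expect_norm_signs_symTensorPow_le_of_hasRademacherType {p q : ℝ} (hp : 1 ≤ p)
    (hq : 1 ≤ q) (hE : HasRademacherType.{u, w} E p) (hk : k ≠ 0) {n : ℕ} (x : Fin n → E) :
    (𝔼 ε : Fin n → ℤˣ, ‖∑ j, ε j • symTensorPow k (x j)‖ ^ q) ^ (1 / q) ≤
      2 * k * kahaneKhintchineConst.{u, w} q p * typeConst.{u, w} E p *
        (∑ j, (‖x j‖ ^ k) ^ p) ^ (1 / p) := by
  have hnorm (j : Fin n) : ‖((k : ℝ) * ‖x j‖ ^ (k - 1)) • x j‖ ^ p = k ^ p * (‖x j‖ ^ k) ^ p := by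
    rw [norm_smul, Real.norm_of_nonneg (by positivity), mul_assoc, pow_sub_one_mul hk,
      Real.mul_rpow (by positivity) (by positivity)]
  have hroot : (∑ j, ‖((k : ℝ) * ‖x j‖ ^ (k - 1)) • x j‖ ^ p) ^ (1 / p) =
      k * (∑ j, (‖x j‖ ^ k) ^ p) ^ (1 / p) := by
    simp only [hnorm]
    rw [← Finset.mul_sum, Real.mul_rpow (by positivity) (by positivity), one_div,
      Real.rpow_rpow_inv (by positivity) (by positivity)]
  refine (expect_norm_signs_symTensorPow_le hq hk x).trans ?_
  have htype := expect_norm_signs_rpow_le_of_hasRademacherType.{u, w} hp (by linarith : 0 < q) hE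
    fun j => ((k : ℝ) * ‖x j‖ ^ (k - 1)) • x j
  rw [hroot] at htype
  linarith

end TensorPower

section Moments

variable {Ω : Type*} [MeasurableSpace Ω] {P : Measure Ω}

theorem eLpNorm_norm_pow {E : Type*} [NormedAddCommGroup E] {k : ℕ} (hk : k ≠ 0) (q : ℝ)
    (ξ : Ω → E) :
    eLpNorm (fun ω => ‖ξ ω‖ ^ k) (ENNReal.ofReal q) P =
      eLpNorm ξ (ENNReal.ofReal (k * q)) P ^ k := by
  have h := eLpNorm_norm_rpow (p := ENNReal.ofReal q) (μ := P) ξ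
    (Nat.cast_pos.2 hk.bot_lt : (0 : ℝ) < k)
  rwa [← ENNReal.ofReal_mul' (Nat.cast_nonneg k), mul_comm, ENNReal.rpow_natCast,
    funext fun ω => Real.rpow_natCast ‖ξ ω‖ k] at h

theorem memLp_comp_of_norm_le_pow {E F : Type*} [NormedAddCommGroup E] [NormedAddCommGroup F]
    {k : ℕ} (hk : k ≠ 0) {q : ℝ} {ξ : Ω → E} (hξ : MemLp ξ (ENNReal.ofReal (k * q)) P) {g : E → F}
    (hg : Continuous g) (h : ∀ x, ‖g x‖ ≤ ‖x‖ ^ k) :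
    MemLp (fun ω => g (ξ ω)) (ENNReal.ofReal q) P :=
  ⟨hg.comp_aestronglyMeasurable hξ.1, (eLpNorm_mono_real fun ω => h (ξ ω)).trans_lt
    ((eLpNorm_norm_pow hk q ξ).trans_lt (ENNReal.pow_lt_top hξ.2))⟩

theorem eLpNorm_sum_norm_rpow_le {ι F : Type*} [Fintype ι] [NormedAddCommGroup F] {f : ι → Ω → F}
    (hf : ∀ j, AEStronglyMeasurable (f j) P) {p q : ℝ} (hp : 0 < p) (hpq : p ≤ q) :
    eLpNorm (fun ω => (∑ j, ‖f j ω‖ ^ p) ^ (1 / p)) (ENNReal.ofReal q) P ≤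
      (∑ j, eLpNorm (f j) (ENNReal.ofReal q) P ^ p) ^ (1 / p) := by
  have hexp : ENNReal.ofReal (q / p) * ENNReal.ofReal p = ENNReal.ofReal q := by
    rw [← ENNReal.ofReal_mul' hp.le, div_mul_cancel₀ q hp.ne']
  have hnorm (ω : Ω) : ‖(∑ j, ‖f j ω‖ ^ p) ^ (1 / p)‖ ^ p = (∑ j, fun ω => ‖f j ω‖ ^ p) ω := by
    rw [Real.norm_of_nonneg (by positivity), one_div,
      Real.rpow_inv_rpow (by positivity) hp.ne', Finset.sum_apply]
  rw [one_div, ENNReal.le_rpow_inv_iff hp, ← one_div, ← hexp, ← eLpNorm_norm_rpow _ hp]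
  simp only [hnorm, ← eLpNorm_norm_rpow _ hp]
  refine eLpNorm_sum_le (fun j _ => ?_) (ENNReal.one_le_ofReal.2 ((one_le_div hp).2 hpq))
  exact ((hf j).norm.aemeasurable.pow_const p).aestronglyMeasurable

variable {E : Type u} [NormedAddCommGroup E] [NormedSpace ℝ E] {k n : ℕ} {p q : ℝ}

theorem inv_mul_sum_const_rpow (hp : 0 < p) (hn : n ≠ 0) (c : ℝ≥0∞) :
    ENNReal.ofReal (n : ℝ)⁻¹ * (∑ _j : Fin n, c ^ p) ^ (1 / p) =
      ENNReal.ofReal ((n : ℝ) ^ (-(1 - 1 / p))) * c := by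
  have hn' : (0 : ℝ) < n := Nat.cast_pos.2 hn.bot_lt
  rw [Finset.sum_const, Finset.card_univ, Fintype.card_fin, nsmul_eq_mul,
    ENNReal.mul_rpow_of_nonneg _ _ (by positivity), one_div, ENNReal.rpow_rpow_inv hp.ne',
    ← ENNReal.ofReal_natCast, ENNReal.ofReal_rpow_of_pos hn', ← mul_assoc,
    ← ENNReal.ofReal_mul (by positivity), ← Real.rpow_neg_one, ← Real.rpow_add hn', neg_sub,
    sub_eq_neg_add]

theorem integrable_tensorPow [IsFiniteMeasure P] (hk : k ≠ 0) (hq : 1 ≤ q) {ξ : Ω → E}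
    (hξ : MemLp ξ (ENNReal.ofReal (k * q)) P) : Integrable (fun ω => tensorPow k (ξ ω)) P :=
  (memLp_comp_of_norm_le_pow hk hξ continuous_tensorPow norm_tensorPow_le).integrable
    (ENNReal.one_le_ofReal.2 hq)

theorem symProj_injMoment {ξ : Ω → E} (h : Integrable (fun ω => tensorPow k (ξ ω)) P) :
    symProj k E (injMoment k ξ P) = ∫ ω, symTensorPow k (ξ ω) ∂P := by
  rw [injMoment, ← ContinuousLinearMap.integral_comp_comm _ h]
  simp only [symProj_tensorPow]

variable [MeasurableSpace E] [BorelSpace E]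

theorem integrable_symTensorPow_map [IsFiniteMeasure P] (hk : k ≠ 0) (hq : 1 ≤ q) {ξ : Ω → E}
    (hξ : MemLp ξ (ENNReal.ofReal (k * q)) P) : Integrable (symTensorPow k) (P.map ξ) := by
  have hmeas : AEStronglyMeasurable (symTensorPow k : E → SymInjTensor k E) (P.map ξ) :=
    continuous_symTensorPow.comp_aestronglyMeasurable hξ.1.aestronglyMeasurable_id_map
  rw [integrable_map_measure hmeas hξ.1.aemeasurable]
  exact (memLp_comp_of_norm_le_pow hk hξ continuous_symTensorPow norm_symTensorPow_le).integrable
    (ENNReal.one_le_ofReal.2 hq)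

theorem integral_symTensorPow_eq_of_identDistrib {ξ η : Ω → E} (hξ : AEStronglyMeasurable ξ P)
    (h : IdentDistrib ξ η P P) :
    ∫ ω, symTensorPow k (ξ ω) ∂P = ∫ ω, symTensorPow k (η ω) ∂P := by
  have hmeas : AEStronglyMeasurable (symTensorPow k : E → SymInjTensor k E) (P.map ξ) :=
    continuous_symTensorPow.comp_aestronglyMeasurable hξ.aestronglyMeasurable_id_map
  rw [← integral_map h.aemeasurable_fst hmeas, h.map_eq,
    integral_map h.aemeasurable_snd (h.map_eq ▸ hmeas)]

theorem symProj_injMoment_sub_mean {ξ : Fin n → Ω → E} (i : Fin n)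
    (hξ : AEStronglyMeasurable (ξ i) P) (hint : Integrable (fun ω => tensorPow k (ξ i ω)) P)
    (hident : ∀ j, IdentDistrib (ξ i) (ξ j) P P) (ω : Ω) :
    symProj k E (injMoment k (ξ i) P) - (n : ℝ)⁻¹ • ∑ j, symTensorPow k (ξ j ω) =
      (n : ℝ)⁻¹ • ∑ j, (∫ ω', symTensorPow k (ξ j ω') ∂P - symTensorPow k (ξ j ω)) := by
  have hn : (n : ℝ) ≠ 0 := Nat.cast_ne_zero.2 i.pos.ne'
  simp only [symProj_injMoment hint, ← integral_symTensorPow_eq_of_identDistrib hξ (hident _)]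
  rw [Finset.sum_sub_distrib, Finset.sum_const, Finset.card_univ, Fintype.card_fin,
    ← Nat.cast_smul_eq_nsmul ℝ, smul_sub, inv_smul_smul₀ hn]

variable [IsProbabilityMeasure P]

theorem eLpNorm_sum_integral_sub_symTensorPow_le (hp : 1 ≤ p) (hpq : p ≤ q)
    (hE : HasRademacherType.{u, w} E p) (hk : k ≠ 0) {ξ : Fin n → Ω → E}
    (hξ : ∀ j, MemLp (ξ j) (ENNReal.ofReal (k * q)) P) (hindep : iIndepFun ξ P) :
    eLpNorm (fun ω => ∑ j, (∫ ω', symTensorPow k (ξ j ω') ∂P - symTensorPow k (ξ j ω)))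
        (ENNReal.ofReal q) P ≤
      ENNReal.ofReal (2 * (2 * k * kahaneKhintchineConst.{u, w} q p * typeConst.{u, w} E p)) *
        (∑ j, (eLpNorm (ξ j) (ENNReal.ofReal (k * q)) P ^ k) ^ p) ^ (1 / p) := by
  set D : ℝ := 2 * k * kahaneKhintchineConst.{u, w} q p * typeConst.{u, w} E p
  have hD : 0 ≤ D := mul_nonneg (mul_nonneg (by positivity)
    (kahaneKhintchineConst_nonneg.{u, w} q p)) (typeConst_nonneg.{u, w} E p)
  have hq : 1 ≤ q := hp.trans hpq
  have hmeas (j : Fin n) : AEStronglyMeasurable (fun ω => ‖ξ j ω‖ ^ k) P := (hξ j).1.norm.pow k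
  calc eLpNorm (fun ω => ∑ j, (∫ ω', symTensorPow k (ξ j ω') ∂P - symTensorPow k (ξ j ω)))
        (ENNReal.ofReal q) P
      ≤ 2 * eLpNorm (fun ω => (𝔼 ε : Fin n → ℤˣ,
          ‖∑ j, ε j • symTensorPow k (ξ j ω)‖ ^ q) ^ (1 / q)) (ENNReal.ofReal q) P :=
        eLpNorm_sum_integral_sub_le_expect_signs (fun j => (hξ j).1.aemeasurable) hindep
          (fun j => integrable_symTensorPow_map hk hq (hξ j)) hq
    _ ≤ 2 * eLpNorm (fun ω => D • (∑ j, (‖ξ j ω‖ ^ k) ^ p) ^ (1 / p)) (ENNReal.ofReal q) P := by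
        gcongr
        refine eLpNorm_mono_real fun ω => ?_
        rw [Real.norm_of_nonneg (Real.rpow_nonneg (expect_norm_signs_rpow_nonneg _ q) _)]
        exact expect_norm_signs_symTensorPow_le_of_hasRademacherType.{u, w} hp hq hE hk (ξ · ω)
    _ = ENNReal.ofReal (2 * D) *
          eLpNorm (fun ω => (∑ j, (‖ξ j ω‖ ^ k) ^ p) ^ (1 / p)) (ENNReal.ofReal q) P := by
        rw [ENNReal.ofReal_mul zero_le_two, ENNReal.ofReal_ofNat, mul_assoc,
          ← Real.enorm_of_nonneg hD]
        exact congrArg (2 * ·) (eLpNorm_const_smul D _ _ _)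
    _ ≤ _ := by
        gcongr
        simpa only [norm_pow, norm_norm, eLpNorm_norm_pow hk q] using
          eLpNorm_sum_norm_rpow_le hmeas (by linarith : 0 < p) hpq

theorem eLpNorm_symProj_injMoment_sub_mean_le (hp : 1 ≤ p) (hpq : p ≤ q)
    (hE : HasRademacherType.{u, w} E p) (hk : k ≠ 0) {ξ : Fin n → Ω → E} (i : Fin n)
    (hξ : ∀ j, MemLp (ξ j) (ENNReal.ofReal (k * q)) P) (hindep : iIndepFun ξ P)
    (hident : ∀ j, IdentDistrib (ξ i) (ξ j) P P) :
    eLpNorm (fun ω => symProj k E (injMoment k (ξ i) P)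
        - (n : ℝ)⁻¹ • ∑ j, symTensorPow k (ξ j ω)) (ENNReal.ofReal q) P ≤
      ENNReal.ofReal (2 * (2 * k * kahaneKhintchineConst.{u, w} q p * typeConst.{u, w} E p) *
          (n : ℝ) ^ (-(1 - 1 / p))) *
        eLpNorm (ξ i) (ENNReal.ofReal (k * q)) P ^ k := by
  set D : ℝ := 2 * (2 * k * kahaneKhintchineConst.{u, w} q p * typeConst.{u, w} E p)
  set S : Ω → SymInjTensor k E :=
    fun ω => ∑ j, (∫ ω', symTensorPow k (ξ j ω') ∂P - symTensorPow k (ξ j ω))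
  have hD : 0 ≤ D := mul_nonneg zero_le_two (mul_nonneg (mul_nonneg (by positivity)
    (kahaneKhintchineConst_nonneg.{u, w} q p)) (typeConst_nonneg.{u, w} E p))
  have hS : eLpNorm S (ENNReal.ofReal q) P ≤ ENNReal.ofReal D *
      (∑ _j : Fin n, (eLpNorm (ξ i) (ENNReal.ofReal (k * q)) P ^ k) ^ p) ^ (1 / p) := by
    simpa only [← (hident _).eLpNorm_eq] using
      eLpNorm_sum_integral_sub_symTensorPow_le.{u, w} hp hpq hE hk hξ hindep
  simp only [symProj_injMoment_sub_mean i (hξ i).1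
    (integrable_tensorPow hk (hp.trans hpq) (hξ i)) hident]
  calc eLpNorm ((n : ℝ)⁻¹ • S) (ENNReal.ofReal q) P
      = ENNReal.ofReal (n : ℝ)⁻¹ * eLpNorm S (ENNReal.ofReal q) P := by
        rw [eLpNorm_const_smul, Real.enorm_of_nonneg (by positivity)]
    _ ≤ ENNReal.ofReal (n : ℝ)⁻¹ * (ENNReal.ofReal D *
          (∑ _j : Fin n, (eLpNorm (ξ i) (ENNReal.ofReal (k * q)) P ^ k) ^ p) ^ (1 / p)) := by
        gcongr
    _ = _ := by
        rw [mul_left_comm, inv_mul_sum_const_rpow (by linarith) i.pos.ne', ← mul_assoc,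
          ← ENNReal.ofReal_mul hD]

end Moments

end MonteCarloMoments

theorem mainTheorem1_general {E : Type u} [NormedAddCommGroup E] [NormedSpace ℝ E]
    [MeasurableSpace E] [BorelSpace E]
    {Ω : Type v} [MeasurableSpace Ω] (P : Measure Ω) [IsProbabilityMeasure P]
    (p q : ℝ) (hp : 1 ≤ p) (hpq : p ≤ q) (hE : HasRademacherType.{u, w} E p)
    (k M : ℕ) (hk : 1 ≤ k) (hM : 0 < M) (ξ : Fin M → Ω → E)
    (hξ : ∀ j, MemLp (ξ j) (ENNReal.ofReal (k * q)) P)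
    (hindep : iIndepFun ξ P) (hident : ∀ i j, IdentDistrib (ξ i) (ξ j) P P) :
    Integrable (fun ω => tensorPow k (ξ ⟨0, hM⟩ ω)) P ∧
    injMoment k (ξ ⟨0, hM⟩) P ∈ symPart k E ∧
    MemLp (fun ω => symProj k E (injMoment k (ξ ⟨0, hM⟩) P)
        - (M : ℝ)⁻¹ • ∑ j, symTensorPow k (ξ j ω)) (ENNReal.ofReal q) P ∧
    eLpNorm (fun ω => symProj k E (injMoment k (ξ ⟨0, hM⟩) P)
        - (M : ℝ)⁻¹ • ∑ j, symTensorPow k (ξ j ω)) (ENNReal.ofReal q) P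
      ≤ ENNReal.ofReal
          (2 * (2 * k * kahaneKhintchineConst.{u, w} q p * typeConst.{u, w} E p) *
            (M : ℝ) ^ (-(1 - 1 / p)))
        * eLpNorm (ξ ⟨0, hM⟩) (ENNReal.ofReal (k * q)) P ^ k := by
  have hk₀ : k ≠ 0 := Nat.one_le_iff_ne_zero.1 hk
  have hint := integrable_tensorPow hk₀ (hp.trans hpq) (hξ ⟨0, hM⟩)
  have hsym (j : Fin M) : MemLp (fun ω => symTensorPow k (ξ j ω)) (ENNReal.ofReal q) P :=
    memLp_comp_of_norm_le_pow hk₀ (hξ j) continuous_symTensorPow norm_symTensorPow_le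
  have hmem : injMoment k (ξ ⟨0, hM⟩) P ∈ symPart k E :=
    convex_symPart.integral_mem isClosed_closure
      (Filter.Eventually.of_forall fun _ => tensorPow_mem_symPart _) hint
  exact ⟨hint, hmem,
    (memLp_const _).sub ((memLp_finsetSum Finset.univ fun j _ => hsym j).const_smul (M : ℝ)⁻¹),
    eLpNorm_symProj_injMoment_sub_mean_le.{u, w} hp hpq hE hk₀ ⟨0, hM⟩ hξ hindep (hident _)⟩

theorem mainTheorem1 {E : Type u} [NormedAddCommGroup E] [NormedSpace ℝ E] [CompleteSpace E]
    [MeasurableSpace E] [BorelSpace E]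
    {Ω : Type v} [MeasurableSpace Ω] (P : Measure Ω) [IsProbabilityMeasure P]
    (p q : ℝ) (hp1 : 1 ≤ p) (hp2 : p ≤ 2) (hpq : p ≤ q)
    (hE : HasRademacherType.{u, w} E p)
    (k M : ℕ) (hk : 1 ≤ k) (hM : 0 < M)
    (ξ : Fin M → Ω → E)
    (hξ : ∀ j, MemLp (ξ j) (ENNReal.ofReal (k * q)) P)
    (hindep : iIndepFun ξ P)
    (hident : ∀ i j, IdentDistrib (ξ i) (ξ j) P P) :
    Integrable (fun ω => tensorPow k (ξ ⟨0, hM⟩ ω)) P ∧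
    injMoment k (ξ ⟨0, hM⟩) P ∈ symPart k E ∧
    MemLp (fun ω => symProj k E (injMoment k (ξ ⟨0, hM⟩) P)
        - (M : ℝ)⁻¹ • ∑ j, symTensorPow k (ξ j ω)) (ENNReal.ofReal q) P ∧
    eLpNorm (fun ω => symProj k E (injMoment k (ξ ⟨0, hM⟩) P)
        - (M : ℝ)⁻¹ • ∑ j, symTensorPow k (ξ j ω)) (ENNReal.ofReal q) P
      ≤ ENNReal.ofReal
          (2 * (2 * k * kahaneKhintchineConst.{u, w} q p * typeConst.{u, w} E p
            + khintchineConst.{w} q) * (M : ℝ) ^ (-(1 - 1 / p)))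
        * eLpNorm (ξ ⟨0, hM⟩) (ENNReal.ofReal (k * q)) P ^ k := by
  obtain ⟨hint, hmem, hLp, hbound⟩ :=
    mainTheorem1_general.{u, v, w} P p q hp1 hpq hE k M hk hM ξ hξ hindep hident
  exact ⟨hint, hmem, hLp, hbound.trans <| by
    gcongr; exact le_add_of_nonneg_right (khintchineConst_nonneg.{w} q)⟩
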